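/- Let $\mathfrak g$ be a $6$-dimensional real Lie algebra that is nilpotent of step exactly two, $G$ the connected, simply connected Lie group with Lie algebra $\mathfrak g$, $\Gamma\subset G$ a lattice (a discrete subgroup with compact quotient), and $M=\Gamma\backslash G$ the corresponding nilmanifold. Let $(J,F)$ be an invariant balanced Hermitian structure on $M$: it is induced by an inner product $g$ on $\mathfrak g$ and a $g$-orthogonal endomorphism $J$ of $\mathfrak g$ with $J^2=-1$ and vanishing Nijenhuis tensor, and the fundamental form $F(\cdot,\cdot)=g(\cdot,J\cdot)$ satisfies $dF\wedge F=0$. We say that $(M,J,F)$ is the total space of an (invariant) $\mathbb T^2$-bundle over $\mathbb T^4$ with anti-self-dual curvature if there are a principal $\mathbb T^2$-bundle $\pi\colon M\to\mathbb T^4=\mathbb R^4/\mathbb Z^4$ that is covered by a Lie group homomorphism $G\to\mathbb R^4$ and whose $\mathbb T^2$-action has left-invariant fundamental vector fields, a flat (translation-invariant) Hermitian structure $(g_0,\omega)$ on $\mathbb T^4$, and left-invariant $1$-forms $\eta_1,\eta_2$ on $M$, the components of a connection form with respect to a basis of the Lie algebra of $\mathbb T^2$, such that $$g=\pi^*g_0+\eta_1^2+\eta_2^2,\qquad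 F=\pi^*\omega+\eta_1\wedge\eta_2,\qquad d\eta_i=\pi^*\Omega_i\quad(i=1,2),$$ where $\Omega_1,\Omega_2$ are translation-invariant $2$-forms on $\mathbb T^4$ that are anti-self-dual for $g_0$ and the orientation $\omega\wedge\omega$. Then $(M,J,F)$ is the total space of a $\mathbb T^2$-bundle over $\mathbb T^4$ with anti-self-dual curvature if and only if the complex structure $J$ is Abelian, that is, $[JX,JY]=[X,Y]$ for all $X,Y\in\mathfrak g$. Moreover, in that case $\mathfrak g$ is isomorphic to $\mathfrak h_3$ or to $\mathfrak h_5$, where, in terms of a basis $e^1,\dots,e^6$ of the dual space and with $e^{ij}=e^i\wedge e^j$, the Lie algebra $\mathfrak h_3$ is given by $de^1=\dots=de^5=0$, $de^6=e^{12}+e^{34}$, and $\mathfrak h_5$ by $de^1=\dots=de^4=0$, $de^5=e^{13}-e^{24}$, $de^6=e^{14}+e^{23}$. -/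

import Mathlib

open scoped Nat

noncomputable section

namespace Nilmanifold

/-! ### Two-step nilpotent Lie algebras and their simply connected Lie groups -/

/-- A real Lie algebra that is nilpotent of step exactly two. -/
class IsTwoStepNilpotent (𝔤 : Type*) [LieRing 𝔤] : Prop where
  lie_lie_eq_zero : ∀ x y z : 𝔤, ⁅x, ⁅y, z⁆⁆ = 0
  exists_lie_ne_zero : ∃ x y : 𝔤, ⁅x, y⁆ ≠ 0

/-- The connected, simply connected Lie group `G` with Lie algebra `𝔤`, when `𝔤` is two-step
nilpotent. The exponential map is a diffeomorphism `𝔤 → G`, and an element of `G` is recorded by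
its logarithm; the product is given by the Baker-Campbell-Hausdorff formula
`exp x * exp y = exp (x + y + [x, y] / 2)`. -/
@[ext] structure SimplyConnectedGroup (𝔤 : Type*) where
  exp ::
  log : 𝔤

namespace SimplyConnectedGroup

variable {𝔤 : Type*} [LieRing 𝔤]

instance : One (SimplyConnectedGroup 𝔤) := ⟨exp 0⟩

instance : Inv (SimplyConnectedGroup 𝔤) := ⟨fun a => exp (-a.log)⟩

@[simp] theorem log_one : (1 : SimplyConnectedGroup 𝔤).log = 0 := rfl

@[simp] theorem log_inv (a : SimplyConnectedGroup 𝔤) : (a⁻¹).log = -a.log := rfl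

variable [LieAlgebra ℝ 𝔤]

instance : Mul (SimplyConnectedGroup 𝔤) :=
  ⟨fun a b => exp (a.log + b.log + (2⁻¹ : ℝ) • ⁅a.log, b.log⁆)⟩

@[simp] theorem log_mul (a b : SimplyConnectedGroup 𝔤) :
    (a * b).log = a.log + b.log + (2⁻¹ : ℝ) • ⁅a.log, b.log⁆ := rfl

instance [IsTwoStepNilpotent 𝔤] : Group (SimplyConnectedGroup 𝔤) :=
  Group.ofLeftAxioms
    (fun a b c => by
      have h : ∀ x y z : 𝔤, ⁅⁅x, y⁆, z⁆ = 0 := fun x y z => by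
        rw [← lie_skew, IsTwoStepNilpotent.lie_lie_eq_zero, neg_zero]
      ext
      simp only [log_mul, lie_add, add_lie, smul_lie, lie_smul, h,
        IsTwoStepNilpotent.lie_lie_eq_zero, smul_zero, smul_add, add_zero]
      abel)
    (fun a => by ext; simp)
    (fun a => by ext; simp)

/-- The topology of the group: that of the finite-dimensional real vector space `𝔤`. -/
instance : TopologicalSpace (SimplyConnectedGroup 𝔤) :=
  (moduleTopology ℝ 𝔤).induced log

end SimplyConnectedGroup

open SimplyConnectedGroup

section Quotient

variable {𝔤 : Type*} [LieRing 𝔤] [LieAlgebra ℝ 𝔤] [IsTwoStepNilpotent 𝔤]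

/-- The quotient `M = Γ \ G`, with the quotient topology. Left-invariant tensors on `G`, that is,
tensors on `𝔤`, descend to it. -/
abbrev Space (Γ : Subgroup (SimplyConnectedGroup 𝔤)) : Type _ :=
  Quotient (QuotientGroup.rightRel Γ)

/-- `Γ` is a lattice: a discrete subgroup with compact quotient `Γ \ G`. -/
structure IsLattice (Γ : Subgroup (SimplyConnectedGroup 𝔤)) : Prop where
  discrete : DiscreteTopology Γ
  cocompact : CompactSpace (Space Γ)

end Quotient

/-! ### Invariant forms and Hermitian structures -/

section Linear

variable {V : Type*} [AddCommGroup V] [Module ℝ V]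

/-- The wedge product of a `p`-form and a `q`-form (as functions of their arguments). -/
def wedge {p q : ℕ} (α : (Fin p → V) → ℝ) (β : (Fin q → V) → ℝ) : (Fin (p + q) → V) → ℝ :=
  fun v => ((p ! * q ! : ℕ) : ℝ)⁻¹ * ∑ σ : Equiv.Perm (Fin (p + q)),
    ((Equiv.Perm.sign σ : ℤ) : ℝ) *
      (α (fun i => v (σ (Fin.castAdd q i))) * β (fun j => v (σ (Fin.natAdd p j))))

/-- A bilinear form, as a function of a pair of vectors. -/
def ofBilin (B : LinearMap.BilinForm ℝ V) : (Fin 2 → V) → ℝ := fun v => B (v 0) (v 1)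

/-- A linear Hermitian structure on a real vector space: an inner product `g` and an orthogonal
endomorphism `J` of square `-1`. -/
structure HermitianStructure (V : Type*) [AddCommGroup V] [Module ℝ V] where
  g : LinearMap.BilinForm ℝ V
  J : V →ₗ[ℝ] V
  g_symm : ∀ x y, g x y = g y x
  g_pos : ∀ x, x ≠ 0 → 0 < g x x
  J_sq : ∀ x, J (J x) = -x
  g_J : ∀ x y, g (J x) (J y) = g x y

/-- The fundamental form `F(x, y) = g(x, J y)`. -/
def HermitianStructure.F (S : HermitianStructure V) : LinearMap.BilinForm ℝ V :=
  S.g.compl₂ S.J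

/-- `f` is a `g`-orthonormal family of four vectors, positively oriented for the orientation
given by `F ∧ F`. -/
structure HermitianStructure.IsOrientedOrthonormal (S : HermitianStructure V)
    (f : Fin 4 → V) : Prop where
  orthonormal : ∀ i j, S.g (f i) (f j) = if i = j then 1 else 0
  oriented : 0 < wedge (ofBilin S.F) (ofBilin S.F) f

/-- On a Hermitian vector space of dimension four, `* Ω = - Ω` for a 2-form `Ω`. The Hodge star
of the metric and of the orientation is determined by `(* Ω)(f₀, f₁) = Ω(f₂, f₃)` for every
oriented orthonormal basis `f`. -/
structure HermitianStructure.IsAntiSelfDual (S : HermitianStructure V)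
    (Ω : LinearMap.BilinForm ℝ V) : Prop where
  isAlt : Ω.IsAlt
  star_eq_neg : ∀ f : Fin 4 → V, S.IsOrientedOrthonormal f → Ω (f 2) (f 3) = -Ω (f 0) (f 1)

end Linear

section Invariant

variable {𝔤 : Type*} [LieRing 𝔤] [LieAlgebra ℝ 𝔤]

/-- The exterior derivative of a left-invariant 1-form. -/
def dOne (η : 𝔤 →ₗ[ℝ] ℝ) : 𝔤 → 𝔤 → ℝ := fun x y => -η ⁅x, y⁆

/-- The exterior derivative of a left-invariant 2-form. -/
def dTwo (B : LinearMap.BilinForm ℝ 𝔤) : (Fin 3 → 𝔤) → ℝ := fun v =>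
  -B ⁅v 0, v 1⁆ (v 2) + B ⁅v 0, v 2⁆ (v 1) - B ⁅v 1, v 2⁆ (v 0)

/-- The Nijenhuis tensor of the invariant almost complex structure vanishes. -/
def HermitianStructure.IsIntegrable (S : HermitianStructure 𝔤) : Prop :=
  ∀ x y, ⁅S.J x, S.J y⁆ - S.J ⁅S.J x, y⁆ - S.J ⁅x, S.J y⁆ - ⁅x, y⁆ = 0

/-- In complex dimension three: `dF ∧ F = 0`. -/
def HermitianStructure.IsBalanced (S : HermitianStructure 𝔤) : Prop :=
  wedge (dTwo S.F) (ofBilin S.F) = 0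

/-- The complex structure is Abelian. -/
def HermitianStructure.IsAbelian (S : HermitianStructure 𝔤) : Prop :=
  ∀ x y, ⁅S.J x, S.J y⁆ = ⁅x, y⁆

end Invariant

/-! ### Torus bundles -/

/-- The class in the torus `ℝⁿ / ℤⁿ` of a vector of `ℝⁿ`. -/
def toTorus {n : ℕ} (u : Fin n → ℝ) : UnitAddTorus (Fin n) := fun i => (u i : UnitAddCircle)

/-- `act` is an action of the torus `Tᵐ` on `M` that makes `π : M → B` a principal `Tᵐ`-bundle:
the action preserves the fibres of `π`, and `π` has equivariant local trivializations. -/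
structure IsPrincipalTorusBundle {M B : Type*} [TopologicalSpace M] [TopologicalSpace B] {m : ℕ}
    (act : UnitAddTorus (Fin m) → M → M) (π : M → B) : Prop where
  zero_act : ∀ p, act 0 p = p
  add_act : ∀ s t p, act (s + t) p = act s (act t p)
  proj_act : ∀ s p, π (act s p) = π p
  exists_trivialization : ∀ b : B, ∃ e : Bundle.Trivialization (UnitAddTorus (Fin m)) π,
    b ∈ e.baseSet ∧ ∀ s, ∀ p ∈ e.source, (e (act s p)).2 = s + (e p).2

/-- An invariant structure of `T²`-bundle over `T⁴` with anti-self-dual curvature on the Hermitian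
nilmanifold `(Γ \ G, J, F)`. -/
structure AntiSelfDualTorusBundle {𝔤 : Type*} [LieRing 𝔤] [LieAlgebra ℝ 𝔤] [IsTwoStepNilpotent 𝔤]
    (Γ : Subgroup (SimplyConnectedGroup 𝔤)) (S : HermitianStructure 𝔤) where
  /-- the bundle projection -/
  π : Space Γ → UnitAddTorus (Fin 4)
  /-- the action of the structure group -/
  act : UnitAddTorus (Fin 2) → Space Γ → Space Γ
  isPrincipal : IsPrincipalTorusBundle act π
  /-- the homomorphism of Lie algebras `𝔤 → ℝ⁴` whose integral `G → ℝ⁴` covers `π` -/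
  P : 𝔤 →ₗ[ℝ] (Fin 4 → ℝ)
  P_lie : ∀ x y : 𝔤, P ⁅x, y⁆ = 0
  π_mk : ∀ x : 𝔤, π (Quotient.mk _ (exp x)) = toTorus (P x)
  /-- the (left-invariant) fundamental vector fields of the action; the flow of a left-invariant
  vector field `x` is the right translation by `exp (t x)` -/
  ξ : (Fin 2 → ℝ) →ₗ[ℝ] 𝔤
  act_mk : ∀ (s : Fin 2 → ℝ) (a : SimplyConnectedGroup 𝔤),
    act (toTorus s) (Quotient.mk _ a) = Quotient.mk _ (a * exp (ξ s))
  /-- the flat Hermitian structure of the base `T⁴` -/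
  base : HermitianStructure (Fin 4 → ℝ)
  /-- the connection 1-forms: the components of a connection form with respect to some basis of
  the Lie algebra of the structure group -/
  η : Fin 2 → (𝔤 →ₗ[ℝ] ℝ)
  η_ξ : Function.Bijective fun (s : Fin 2 → ℝ) (i : Fin 2) => η i (ξ s)
  /-- `g = π^* g_base + η₁² + η₂²` -/
  g_eq : ∀ x y, S.g x y = base.g (P x) (P y) + η 0 x * η 0 y + η 1 x * η 1 y
  /-- `F = π^* F_base + η₁ ∧ η₂` -/
  F_eq : ∀ x y, S.F x y = base.F (P x) (P y) + (η 0 x * η 1 y - η 1 x * η 0 y)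
  /-- the curvature 2-forms on `T⁴` -/
  Ω : Fin 2 → LinearMap.BilinForm ℝ (Fin 4 → ℝ)
  dη_eq : ∀ i x y, dOne (η i) x y = Ω i (P x) (P y)
  antiSelfDual : ∀ i, base.IsAntiSelfDual (Ω i)

/-! ### The Lie algebras `𝔥₃` and `𝔥₅` -/

/-- The Lie algebra with `de¹ = ⋯ = de⁵ = 0` and `de⁶ = e¹² + e³⁴`. -/
def H3 : Type := Fin 6 → ℝ

/-- The Lie algebra with `de¹ = ⋯ = de⁴ = 0`, `de⁵ = e¹³ - e²⁴` and `de⁶ = e¹⁴ + e²³`. -/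
def H5 : Type := Fin 6 → ℝ

namespace H3

instance : AddCommGroup H3 := inferInstanceAs (AddCommGroup (Fin 6 → ℝ))

instance : Module ℝ H3 := inferInstanceAs (Module ℝ (Fin 6 → ℝ))

/-- The bracket, determined by `deᵏ(x, y) = -eᵏ([x, y])`. -/
instance : Bracket H3 H3 :=
  ⟨fun x y => ![0, 0, 0, 0, 0, -((x 0 * y 1 - x 1 * y 0) + (x 2 * y 3 - x 3 * y 2))]⟩

theorem add_apply (x y : H3) (i : Fin 6) : (x + y) i = x i + y i := rfl

theorem smul_apply (c : ℝ) (x : H3) (i : Fin 6) : (c • x) i = c * x i := rfl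

theorem zero_apply (i : Fin 6) : (0 : H3) i = 0 := rfl

theorem lie_apply (x y : H3) (i : Fin 6) : ⁅x, y⁆ i =
    ![0, 0, 0, 0, 0, -((x 0 * y 1 - x 1 * y 0) + (x 2 * y 3 - x 3 * y 2))] i := rfl

instance : LieRing H3 where
  add_lie x y z := by
    funext i; fin_cases i <;> simp [lie_apply, add_apply] <;> ring
  lie_add x y z := by
    funext i; fin_cases i <;> simp [lie_apply, add_apply] <;> ring
  lie_self x := by
    funext i; fin_cases i <;> simp [lie_apply, zero_apply] <;> ring
  leibniz_lie x y z := by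
    funext i; fin_cases i <;> simp [lie_apply, add_apply]

instance : LieAlgebra ℝ H3 where
  lie_smul c x y := by
    funext i; fin_cases i <;> simp [lie_apply, smul_apply] <;> ring

end H3

namespace H5

instance : AddCommGroup H5 := inferInstanceAs (AddCommGroup (Fin 6 → ℝ))

instance : Module ℝ H5 := inferInstanceAs (Module ℝ (Fin 6 → ℝ))

/-- The bracket, determined by `deᵏ(x, y) = -eᵏ([x, y])`. -/
instance : Bracket H5 H5 :=
  ⟨fun x y => ![0, 0, 0, 0, -((x 0 * y 2 - x 2 * y 0) - (x 1 * y 3 - x 3 * y 1)),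
    -((x 0 * y 3 - x 3 * y 0) + (x 1 * y 2 - x 2 * y 1))]⟩

theorem add_apply (x y : H5) (i : Fin 6) : (x + y) i = x i + y i := rfl

theorem smul_apply (c : ℝ) (x : H5) (i : Fin 6) : (c • x) i = c * x i := rfl

theorem zero_apply (i : Fin 6) : (0 : H5) i = 0 := rfl

theorem lie_apply (x y : H5) (i : Fin 6) : ⁅x, y⁆ i =
    ![0, 0, 0, 0, -((x 0 * y 2 - x 2 * y 0) - (x 1 * y 3 - x 3 * y 1)),
      -((x 0 * y 3 - x 3 * y 0) + (x 1 * y 2 - x 2 * y 1))] i := rfl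

instance : LieRing H5 where
  add_lie x y z := by
    funext i; fin_cases i <;> simp [lie_apply, add_apply] <;> ring
  lie_add x y z := by
    funext i; fin_cases i <;> simp [lie_apply, add_apply] <;> ring
  lie_self x := by
    funext i; fin_cases i <;> simp [lie_apply, zero_apply] <;> ring
  leibniz_lie x y z := by
    funext i; fin_cases i <;> simp [lie_apply, add_apply]

instance : LieAlgebra ℝ H5 where
  lie_smul c x y := by
    funext i; fin_cases i <;> simp [lie_apply, smul_apply] <;> ring

end H5

end Nilmanifold

end

/-!
If `J` is Abelian, then the centre of `𝔤` is `J`-invariant. Contracting `dF ∧ F = 0` with a central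
vector `J z` shows that `d (g z) ∧ F` vanishes on the orthogonal complement of the centre. For a
four-dimensional centre this would kill the bracket, so the centre is a `J`-invariant plane and the
curvatures `d (g z)` are primitive forms of type `(1, 1)` on its four-dimensional complement, that
is, they are anti-self-dual. A lattice `Γ` is a lattice modulo the centre, because commutators embed
the image of `Γ` discretely into a power of `Γ`, and its intersection with the centre spans, because
otherwise a linear form on `𝔤` would descend to an unbounded function on the compact `Γ \ G`. Hence
`Γ \ G` is a principal torus bundle over a torus.

Conversely, anti-self-dual forms are `J`-invariant, and the components of the bracket are curvature
forms.

For the classification, the complement of the centre is identified with the quaternions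
`ℝ a ⊕ ℝ³`. The anti-self-dual equations say that the bracket is determined by the linear map
`n ↦ [q n, a]` from `ℝ³` to the centre, and a basis of `ℝ³` adapted to its kernel gives `𝔥₃` when
the rank is one and `𝔥₅` when it is two.
-/

noncomputable section

namespace Nilmanifold

open SimplyConnectedGroup

/-! ### Wedge products -/

section Wedge

variable {V : Type*}

/-- The alternating sum of a function of `n` vectors over the rearrangements of its arguments. -/
def alternation (n : ℕ) (G : (Fin n → V) → ℝ) (v : Fin n → V) : ℝ :=
  ∑ σ : Equiv.Perm (Fin n), ((Equiv.Perm.sign σ : ℤ) : ℝ) * G (v ∘ σ)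

theorem decomposeFin_symm_mul_cycleRange_bijective (n : ℕ) :
    Function.Bijective fun x : Fin (n + 1) × Equiv.Perm (Fin n) =>
      Equiv.Perm.decomposeFin.symm (0, x.2) * x.1.cycleRange := by
  refine (Fintype.bijective_iff_injective_and_card _).2 ⟨?_, by
    simp [Fintype.card_perm, Nat.factorial_succ]⟩
  rintro ⟨p, σ⟩ ⟨q, τ⟩ h
  have hp : ∀ (r : Fin (n + 1)) (ρ : Equiv.Perm (Fin n)),
      (Equiv.Perm.decomposeFin.symm (0, ρ) * r.cycleRange)⁻¹ 0 = r := fun r ρ => by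
    rw [Equiv.Perm.inv_eq_iff_eq]
    simp
  obtain rfl : p = q := by rw [← hp p σ, ← hp q τ]; exact congrArg (fun ρ => ρ⁻¹ 0) h
  have hσ : σ = τ := by simpa using h
  rw [hσ]

theorem alternation_cons {n : ℕ} (G : (Fin (n + 1) → V) → ℝ) (x : V) (v : Fin n → V) :
    alternation (n + 1) G (Fin.cons x v) =
      ∑ p : Fin (n + 1), (-1) ^ (p : ℕ) * alternation n (fun w => G (p.insertNth x w)) v := by
  have hcomp : ∀ (p : Fin (n + 1)) (σ : Equiv.Perm (Fin n)),
      (Fin.cons x v : Fin (n + 1) → V) ∘ (Equiv.Perm.decomposeFin.symm (0, σ) * p.cycleRange) =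
        p.insertNth x (v ∘ σ) := fun p σ => by
    refine (Fin.eq_insertNth_iff).2 ⟨by simp, funext fun i => ?_⟩
    simp [Fin.removeNth]
  rw [alternation, ← (decomposeFin_symm_mul_cycleRange_bijective n).sum_comp,
    Fintype.sum_prod_type]
  refine Finset.sum_congr rfl fun p _ => ?_
  rw [alternation, Finset.mul_sum]
  refine Finset.sum_congr rfl fun σ _ => ?_
  rw [hcomp, map_mul, Equiv.Perm.decomposeFin.symm_sign, Fin.sign_cycleRange, if_pos rfl]
  push_cast
  ring

theorem alternation_zero (G : (Fin 0 → V) → ℝ) (v : Fin 0 → V) : alternation 0 G v = G v := by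
  simp [alternation, Subsingleton.elim (v ∘ _) v]

theorem wedge_eq_alternation {p q : ℕ} (α : (Fin p → V) → ℝ) (β : (Fin q → V) → ℝ)
    (v : Fin (p + q) → V) :
    wedge α β v = ((p ! * q ! : ℕ) : ℝ)⁻¹ *
      alternation (p + q) (fun w => α (w ∘ Fin.castAdd q) * β (w ∘ Fin.natAdd p)) v :=
  rfl

theorem wedge_three_two_cons {α : (Fin 3 → V) → ℝ} {β : (Fin 2 → V) → ℝ} {x : V}
    (hα : ∀ (p : Fin 3) w, α (p.insertNth x w) = (-1) ^ (p : ℕ) * α (Fin.cons x w))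
    {f : Fin 4 → V} (hβ : ∀ (p : Fin 2) i, β (p.insertNth x fun _ => f i) = 0) :
    wedge α β (Fin.cons x f) = wedge (fun w => α (Fin.cons x w)) β f := by
  have hfirst : ∀ p : Fin 3, alternation 4 (fun w =>
      α (Fin.insertNth (α := fun _ => V) (p.castAdd 2) x w ∘ Fin.castAdd 2) *
        β (Fin.insertNth (α := fun _ => V) (p.castAdd 2) x w ∘ Fin.natAdd 3)) f =
      (-1) ^ (p : ℕ) * alternation (2 + 2) (fun w =>
        α (Fin.cons x (w ∘ Fin.castAdd 2)) * β (w ∘ Fin.natAdd 2)) f := fun p => by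
    rw [alternation, alternation, Finset.mul_sum]
    refine Finset.sum_congr rfl fun σ _ => ?_
    have hcast : (Fin.insertNth (α := fun _ => V) (p.castAdd 2) x (f ∘ σ)) ∘ Fin.castAdd 2 =
        p.insertNth x ((f ∘ σ) ∘ Fin.castAdd 2) := by
      funext i; fin_cases p <;> fin_cases i <;> rfl
    have hnat : (Fin.insertNth (α := fun _ => V) (p.castAdd 2) x (f ∘ σ)) ∘ Fin.natAdd 3 =
        (f ∘ σ) ∘ (Fin.natAdd 2 : Fin 2 → Fin 4) := by
      funext i; fin_cases p <;> fin_cases i <;> rfl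
    rw [hcast, hnat, hα]
    ring
  have hlast : ∀ j : Fin 2, alternation 4 (fun w =>
      α (Fin.insertNth (α := fun _ => V) (j.natAdd 3) x w ∘ Fin.castAdd 2) *
        β (Fin.insertNth (α := fun _ => V) (j.natAdd 3) x w ∘ Fin.natAdd 3)) f = 0 := fun j =>
    Finset.sum_eq_zero fun σ _ => by
      have hnat : Fin.insertNth (α := fun _ => V) (j.natAdd 3) x (f ∘ σ) ∘ Fin.natAdd 3 =
          j.insertNth x fun _ => f (σ 3) := by
        funext i; fin_cases j <;> fin_cases i <;> rfl
      simp only [hnat, hβ, mul_zero]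
  rw [wedge_eq_alternation, wedge_eq_alternation, alternation_cons (n := 4),
    Fin.sum_univ_add (a := 3) (b := 2)]
  have hsign : ∀ (p : Fin 3) (c : ℝ), (-1) ^ (p : ℕ) * ((-1) ^ (p : ℕ) * c) = c := fun p c => by
    rw [← mul_assoc, ← mul_pow, neg_one_mul, neg_neg, one_pow, one_mul]
  simp only [hfirst, hlast, mul_zero, Finset.sum_const_zero, add_zero, Fin.val_castAdd, hsign,
    Finset.sum_const, Finset.card_univ, Fintype.card_fin, nsmul_eq_mul, Nat.factorial]
  push_cast
  ring

variable [AddCommGroup V] [Module ℝ V]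

theorem wedge_two_two {A B : LinearMap.BilinForm ℝ V} (hA : A.IsAlt) (hB : B.IsAlt)
    (v : Fin 4 → V) :
    wedge (ofBilin A) (ofBilin B) v =
      A (v 0) (v 1) * B (v 2) (v 3) - A (v 0) (v 2) * B (v 1) (v 3)
        + A (v 0) (v 3) * B (v 1) (v 2) + A (v 1) (v 2) * B (v 0) (v 3)
        - A (v 1) (v 3) * B (v 0) (v 2) + A (v 2) (v 3) * B (v 0) (v 1) := by
  obtain ⟨a, b, c, d, rfl⟩ : ∃ a b c d, v = ![a, b, c, d] :=
    ⟨v 0, v 1, v 2, v 3, by simp [← List.ofFn_inj]⟩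
  rw [wedge_eq_alternation]
  have hA' : ∀ (x y z t : V) w, ofBilin A
      ((Fin.cons x (Fin.cons y (Fin.cons z (Fin.cons t w))) : Fin 4 → V) ∘ Fin.castAdd 2) = A x y :=
    fun _ _ _ _ _ => rfl
  have hB' : ∀ (x y z t : V) w, ofBilin B
      ((Fin.cons x (Fin.cons y (Fin.cons z (Fin.cons t w))) : Fin 4 → V) ∘ Fin.natAdd 2) = B z t :=
    fun _ _ _ _ _ => rfl
  simp only [Matrix.cons_val]
  simp only [alternation_cons, alternation_zero, Matrix.vecCons, Fin.sum_univ_succ,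
    Fin.insertNth_zero', Fin.insertNth_succ_cons, hA', hB', Finset.univ_eq_empty,
    Finset.sum_empty, Fin.val_zero, Fin.val_succ, Nat.factorial]
  simp only [← hA.neg_eq a b, ← hA.neg_eq a c, ← hA.neg_eq a d, ← hA.neg_eq b c, ← hA.neg_eq b d,
    ← hA.neg_eq c d, ← hB.neg_eq a b, ← hB.neg_eq a c, ← hB.neg_eq a d, ← hB.neg_eq b c,
    ← hB.neg_eq b d, ← hB.neg_eq c d]
  ring

end Wedge

/-! ### Anti-self-dual forms on Hermitian vector spaces -/

namespace HermitianStructure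

variable {V : Type*} [AddCommGroup V] [Module ℝ V] (S : HermitianStructure V)

theorem F_apply (x y : V) : S.F x y = S.g x (S.J y) := rfl

theorem g_J_left (x y : V) : S.g (S.J x) y = -S.g x (S.J y) := by
  rw [← S.g_J x, S.J_sq, map_neg, neg_neg]

theorem g_self_J (x : V) : S.g x (S.J x) = 0 := by
  have h := S.g_J_left x x
  rw [S.g_symm] at h
  linarith

theorem F_isAlt : S.F.IsAlt := S.g_self_J

theorem F_swap (x y : V) : S.F x y = -S.F y x := (S.F_isAlt.neg_eq y x).symm

theorem exists_smul_unit {x : V} (hx : x ≠ 0) : ∃ c : ℝ, c ≠ 0 ∧ S.g (c • x) (c • x) = 1 := by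
  have hpos := S.g_pos x hx
  refine ⟨(√(S.g x x))⁻¹, inv_ne_zero (Real.sqrt_pos.2 hpos).ne', ?_⟩
  simp only [map_smul, LinearMap.smul_apply, smul_eq_mul]
  rw [← mul_assoc, ← mul_inv, Real.mul_self_sqrt hpos.le, inv_mul_cancel₀ hpos.ne']

section Orthonormal

variable {S} {ι : Type*} {W : Submodule ℝ V}

theorem exists_unit_mem_orthogonal [Fintype ι] [Module.Finite ℝ W]
    (hW : Fintype.card ι < Module.finrank ℝ W) (f : ι → V) :
    ∃ u ∈ W, S.g u u = 1 ∧ ∀ i, S.g (f i) u = 0 := by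
  have hker := LinearMap.ker_ne_bot_of_finrank_lt
    (f := (LinearMap.pi fun i => S.g (f i)) ∘ₗ W.subtype) (by simpa using hW)
  obtain ⟨⟨x, hxW⟩, hx, hx0⟩ := Submodule.exists_mem_ne_zero_of_ne_bot hker
  obtain ⟨c, -, hc⟩ := S.exists_smul_unit fun h : x = 0 => hx0 (Subtype.ext h)
  refine ⟨c • x, W.smul_mem c hxW, hc, fun i => ?_⟩
  have hi : S.g (f i) x = 0 := congrFun (LinearMap.mem_ker.1 hx) i
  rw [map_smul, hi, smul_zero]

variable [DecidableEq ι] {f : ι → V}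

theorem linearIndependent_of_orthonormal
    (hf : ∀ i j, S.g (f i) (f j) = if i = j then 1 else 0) : LinearIndependent ℝ f :=
  LinearMap.linearIndependent_of_isOrthoᵢ (B := S.g)
    (fun i j hij => by simp [Function.onFun, hf, hij]) fun i => by
      simp [hf]

theorem eq_sum_of_orthonormal [Fintype ι] [Module.Finite ℝ W]
    (hW : Module.finrank ℝ W = Fintype.card ι) (hfW : ∀ i, f i ∈ W)
    (hf : ∀ i j, S.g (f i) (f j) = if i = j then 1 else 0) {x : V} (hx : x ∈ W) :
    x = ∑ i, S.g (f i) x • f i := by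
  have hspan : Submodule.span ℝ (Set.range f) = W :=
    Submodule.eq_of_le_of_finrank_eq (Submodule.span_le.2 (Set.range_subset_iff.2 hfW))
      (by rw [finrank_span_eq_card (linearIndependent_of_orthonormal hf), hW])
  rw [← hspan] at hx
  obtain ⟨c, rfl⟩ := (Submodule.mem_span_range_iff_exists_fun ℝ).1 hx
  simp [hf]

/-- A family of vectors that is orthonormal for the Hermitian product with real part `g`; the
imaginary part of that product is, up to sign, the fundamental form. -/
structure IsUnitary (S : HermitianStructure V) (f : ι → V) : Prop where
  orthonormal : ∀ i j, S.g (f i) (f j) = if i = j then 1 else 0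
  g_J_eq_zero : ∀ i j, S.g (f i) (S.J (f j)) = 0

namespace IsUnitary

theorem vecCons {n : ℕ} {f : Fin n → V} (hf : S.IsUnitary f) {u : V} (hu : S.g u u = 1)
    (horth : ∀ i, S.g (f i) u = 0) (hJ : ∀ i, S.g (S.J (f i)) u = 0) :
    S.IsUnitary (Matrix.vecCons u f) := by
  have horth' : ∀ i, S.g u (f i) = 0 := fun i => by rw [S.g_symm, horth]
  have hJ' : ∀ i, S.g u (S.J (f i)) = 0 := fun i => by rw [S.g_symm, hJ]
  have hJ'' : ∀ i, S.g (f i) (S.J u) = 0 := fun i => by rw [← neg_eq_zero, ← S.g_J_left, hJ]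
  constructor <;> intro i j <;> refine Fin.cases ?_ (fun i => ?_) i <;>
    refine Fin.cases ?_ (fun j => ?_) j <;>
    simp [hf.orthonormal, hf.g_J_eq_zero, hu, horth, horth', hJ', hJ'', S.g_self_J,
      (Fin.succ_ne_zero _).symm]

theorem comp {κ : Type*} [DecidableEq κ] (hf : S.IsUnitary f) {e : κ → ι}
    (he : Function.Injective e) : S.IsUnitary (f ∘ e) :=
  ⟨fun i j => by simp [hf.orthonormal, he.eq_iff], fun _ _ => hf.g_J_eq_zero _ _⟩

theorem exists_vecCons {n : ℕ} {f : Fin n → V} (hf : S.IsUnitary f) [Module.Finite ℝ W]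
    (hW : 2 * n < Module.finrank ℝ W) : ∃ u ∈ W, S.IsUnitary (Matrix.vecCons u f) := by
  obtain ⟨u, huW, hu, horth⟩ := exists_unit_mem_orthogonal (S := S) (W := W)
    (by simpa [two_mul] using hW) (Sum.elim f fun i => S.J (f i))
  exact ⟨u, huW, hf.vecCons hu (fun i => horth (Sum.inl i)) fun i => horth (Sum.inr i)⟩

theorem singleton {c : V} (hc : S.g c c = 1) : S.IsUnitary ![c] :=
  vecCons ⟨fun i => i.elim0, fun i => i.elim0⟩ hc (fun i => i.elim0) fun i => i.elim0

theorem orthonormal_sumElim {f : ι → V} (hf : S.IsUnitary f) (i j : ι ⊕ ι) :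
    S.g (Sum.elim f (fun i => S.J (f i)) i) (Sum.elim f (fun i => S.J (f i)) j) =
      if i = j then 1 else 0 := by
  rcases i with i | i <;> rcases j with j | j <;>
    simp [hf.orthonormal, hf.g_J_eq_zero, S.g_J, S.g_J_left]

theorem two_mul_card_le_finrank [Fintype ι] [Module.Finite ℝ W] (hf : S.IsUnitary f)
    (hfW : ∀ i, f i ∈ W) (hJW : ∀ i, S.J (f i) ∈ W) :
    2 * Fintype.card ι ≤ Module.finrank ℝ W := by
  have hspan : Submodule.span ℝ (Set.range (Sum.elim f fun i => S.J (f i))) ≤ W :=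
    Submodule.span_le.2 (Set.range_subset_iff.2 (Sum.rec hfW hJW))
  simpa [finrank_span_eq_card (linearIndependent_of_orthonormal hf.orthonormal_sumElim), two_mul]
    using Submodule.finrank_mono hspan

theorem eq_sum [Fintype ι] [Module.Finite ℝ W] (hf : S.IsUnitary f)
    (hW : Module.finrank ℝ W = 2 * Fintype.card ι) (hfW : ∀ i, f i ∈ W)
    (hJW : ∀ i, S.J (f i) ∈ W) {x : V} (hx : x ∈ W) :
    x = ∑ i, (S.g (f i) x • f i + S.g (S.J (f i)) x • S.J (f i)) := by
  rw [Finset.sum_add_distrib]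
  simpa using eq_sum_of_orthonormal (by simpa [two_mul] using hW)
    (fun i => by rcases i with i | i <;> simp [hfW, hJW]) hf.orthonormal_sumElim hx

theorem isOrientedOrthonormal {u w : V} (h : S.IsUnitary ![u, w]) :
    S.IsOrientedOrthonormal ![u, w, S.J w, S.J u] := by
  have huu : S.g u u = 1 := h.orthonormal 0 0
  have hww : S.g w w = 1 := h.orthonormal 1 1
  have huw : S.g u w = 0 := h.orthonormal 0 1
  have hwu : S.g w u = 0 := h.orthonormal 1 0
  have huJ : S.g u (S.J w) = 0 := h.g_J_eq_zero 0 1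
  have hwJ : S.g w (S.J u) = 0 := h.g_J_eq_zero 1 0
  refine ⟨fun i j => ?_, ?_⟩
  · fin_cases i <;> fin_cases j <;>
      simp [S.g_J, huu, hww, huw, hwu, huJ, hwJ, S.g_self_J, S.g_J_left]
  · rw [wedge_two_two S.F_isAlt S.F_isAlt]
    simp [F_apply, S.J_sq, huu, hww, huw, hwu, huJ]

end IsUnitary

end Orthonormal

variable {S}

theorem IsAntiSelfDual.map_J_of_isUnitary {Ω : LinearMap.BilinForm ℝ V}
    (hΩ : S.IsAntiSelfDual Ω) {u w : V} (h : S.IsUnitary ![u, w]) :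
    Ω (S.J u) (S.J w) = Ω u w := by
  have hstar : Ω (S.J w) (S.J u) = -Ω u w := hΩ.star_eq_neg _ h.isOrientedOrthonormal
  rw [← hΩ.isAlt.neg_eq, hstar, neg_neg]

theorem IsAntiSelfDual.map_J_of_orthogonal {Ω : LinearMap.BilinForm ℝ V}
    (hΩ : S.IsAntiSelfDual Ω) {u w : V} (huw : S.g u w = 0) (hJ : S.g u (S.J w) = 0) :
    Ω (S.J u) (S.J w) = Ω u w := by
  rcases eq_or_ne u 0 with rfl | hu
  · simp
  rcases eq_or_ne w 0 with rfl | hw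
  · simp
  obtain ⟨s, hs, hs1⟩ := S.exists_smul_unit hu
  obtain ⟨t, ht, ht1⟩ := S.exists_smul_unit hw
  have hunitary : S.IsUnitary ![s • u, t • w] :=
    (IsUnitary.singleton ht1).vecCons hs1 (fun i => by simp [S.g_symm w, huw])
      fun i => by simp [S.g_symm _ u, hJ]
  simpa [hs, ht] using hΩ.map_J_of_isUnitary hunitary

theorem IsAntiSelfDual.map_J {Ω : LinearMap.BilinForm ℝ V} (hΩ : S.IsAntiSelfDual Ω) (u v : V) :
    Ω (S.J u) (S.J v) = Ω u v := by
  rcases eq_or_ne u 0 with rfl | hu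
  · simp
  have hpos := (S.g_pos u hu).ne'
  obtain ⟨α, β, w, rfl, huw, hJ⟩ : ∃ (α β : ℝ) (w : V), v = α • u + β • S.J u + w ∧
      S.g u w = 0 ∧ S.g u (S.J w) = 0 := by
    refine ⟨S.g u v / S.g u u, S.g (S.J u) v / S.g u u, v - (S.g u v / S.g u u) • u -
      (S.g (S.J u) v / S.g u u) • S.J u, by abel, ?_, ?_⟩
    · simp [S.g_self_J, hpos]
    · simp [S.g_self_J, hpos, S.J_sq, S.g_J_left]
  have hswap : Ω (S.J u) u = -Ω u (S.J u) := (hΩ.isAlt.neg_eq _ _).symm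
  simp [hΩ.map_J_of_orthogonal huw hJ, hswap, hΩ.isAlt.self_eq_zero, S.J_sq]

section FourDimensional

variable [Module.Finite ℝ V]

variable {ι : Type*} [Fintype ι] [DecidableEq ι] {f : ι → V}

theorem J_eq_sum_of_orthonormal
    (hdim : Module.finrank ℝ V = Fintype.card ι)
    (hf : ∀ i j, S.g (f i) (f j) = if i = j then 1 else 0) (j : ι) :
    S.J (f j) = ∑ i, S.F (f i) (f j) • f i :=
  eq_sum_of_orthonormal (W := ⊤) (by rw [finrank_top, hdim]) (fun _ => trivial) hf trivial

theorem sum_F_mul_F_of_orthonormal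
    (hdim : Module.finrank ℝ V = Fintype.card ι)
    (hf : ∀ i j, S.g (f i) (f j) = if i = j then 1 else 0) (i j : ι) :
    ∑ k, S.F (f k) (f i) * S.F (f k) (f j) = if i = j then 1 else 0 := by
  rw [← hf i j, ← S.g_J (f i) (f j), J_eq_sum_of_orthonormal hdim hf i]
  simp [F_apply]

/-- The matrix of `F` is orthogonal and skew; hence its dual is `pf⁻¹` times itself, where the
Pfaffian `pf` is a sign, positive by the choice of the orientation. -/
theorem IsOrientedOrthonormal.F_selfDual {f : Fin 4 → V} (hdim : Module.finrank ℝ V = 4)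
    (hf : S.IsOrientedOrthonormal f) :
    S.F (f 2) (f 3) = S.F (f 0) (f 1) ∧ S.F (f 1) (f 3) = -S.F (f 0) (f 2) ∧
      S.F (f 1) (f 2) = S.F (f 0) (f 3) := by
  have horth := sum_F_mul_F_of_orthonormal (S := S) (f := f) (by simpa using hdim) hf.orthonormal
  have h00 := horth 0 0
  have h11 := horth 1 1
  have h22 := horth 2 2
  have h33 := horth 3 3
  have h01 := horth 0 1
  have h02 := horth 0 2
  have h03 := horth 0 3
  have hpos := hf.oriented
  rw [wedge_two_two S.F_isAlt S.F_isAlt] at hpos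
  simp only [Fin.sum_univ_four, S.F_isAlt.self_eq_zero, S.F_swap (f 1) (f 0),
    S.F_swap (f 2) (f 0), S.F_swap (f 3) (f 0), S.F_swap (f 2) (f 1), S.F_swap (f 3) (f 1),
    S.F_swap (f 3) (f 2), Fin.reduceEq, if_true, if_false] at h00 h11 h22 h33 h01 h02 h03
  generalize S.F (f 0) (f 1) = a at *
  generalize S.F (f 0) (f 2) = b at *
  generalize S.F (f 0) (f 3) = c at *
  generalize S.F (f 1) (f 2) = d at *
  generalize S.F (f 1) (f 3) = e at *
  generalize S.F (f 2) (f 3) = k at *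
  obtain ⟨pf, hpf⟩ : ∃ pf, pf = a * k - b * e + c * d := ⟨_, rfl⟩
  have hk : pf * a = k := by rw [hpf]; linear_combination k * h00 + b * h03 - c * h02
  have he : pf * b = -e := by rw [hpf]; linear_combination -e * h00 - a * h03 + c * h01
  have hd : pf * c = d := by rw [hpf]; linear_combination d * h00 + a * h02 - b * h01
  have hsq : pf ^ 2 = 1 := by
    have hdek : d ^ 2 + e ^ 2 + k ^ 2 = 1 := by linarith
    rw [sq]
    nth_rewrite 2 [hpf]
    linear_combination k * hk - e * he + d * hd + hdek
  obtain rfl : pf = 1 := (pow_eq_one_iff_of_nonneg (by linarith) two_ne_zero).1 hsq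
  exact ⟨by linarith, by linarith, by linarith⟩

theorem isAntiSelfDual_of_primitive (hdim : Module.finrank ℝ V = 4)
    {Ω : LinearMap.BilinForm ℝ V} (hΩ : Ω.IsAlt) (hJ : ∀ u v, Ω (S.J u) (S.J v) = Ω u v)
    (hprim : wedge (ofBilin Ω) (ofBilin S.F) = 0) : S.IsAntiSelfDual Ω := by
  refine ⟨hΩ, fun f hf => ?_⟩
  obtain ⟨h23, h13, h12⟩ := hf.F_selfDual hdim
  have hcard : Module.finrank ℝ V = Fintype.card (Fin 4) := by simpa using hdim
  have hunit := sum_F_mul_F_of_orthonormal hcard hf.orthonormal 0 0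
  have hwedge : wedge (ofBilin Ω) (ofBilin S.F) f = 0 := by rw [hprim]; rfl
  have hinv := hJ (f 0) (f 1)
  rw [wedge_two_two hΩ S.F_isAlt] at hwedge
  rw [J_eq_sum_of_orthonormal hcard hf.orthonormal 0,
    J_eq_sum_of_orthonormal hcard hf.orthonormal 1] at hinv
  simp only [Fin.sum_univ_four, map_add, map_smul, LinearMap.add_apply, LinearMap.smul_apply,
    smul_eq_mul, S.F_isAlt.self_eq_zero, hΩ.self_eq_zero, S.F_swap (f 1) (f 0),
    S.F_swap (f 2) (f 0), S.F_swap (f 3) (f 0), S.F_swap (f 2) (f 1), S.F_swap (f 3) (f 1),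
    ← hΩ.neg_eq (f 0) (f 1), ← hΩ.neg_eq (f 0) (f 2), ← hΩ.neg_eq (f 0) (f 3),
    ← hΩ.neg_eq (f 1) (f 2), ← hΩ.neg_eq (f 1) (f 3), ← hΩ.neg_eq (f 2) (f 3), if_true,
    h23, h13, h12] at hunit hinv hwedge
  linear_combination (-hinv) + (S.F (f 0) (f 1) * hwedge) - Ω (f 2) (f 3) * hunit

end FourDimensional

end HermitianStructure

/-! ### Balanced structures with Abelian complex structure -/

section Centre

variable {𝔤 : Type*} [LieRing 𝔤] [LieAlgebra ℝ 𝔤]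

theorem lie_eq_zero_of_mem_center {x : 𝔤} (hx : x ∈ LieAlgebra.center ℝ 𝔤) (y : 𝔤) :
    ⁅x, y⁆ = 0 := by
  rw [← lie_skew, (LieModule.mem_maxTrivSubmodule ℝ 𝔤 𝔤 x).1 hx, neg_zero]

theorem lie_eq_zero_of_mem_center_right {x : 𝔤} (hx : x ∈ LieAlgebra.center ℝ 𝔤) (y : 𝔤) :
    ⁅y, x⁆ = 0 :=
  (LieModule.mem_maxTrivSubmodule ℝ 𝔤 𝔤 x).1 hx y

theorem mem_center_of_forall_lie_eq_zero {x : 𝔤} (hx : ∀ y : 𝔤, ⁅x, y⁆ = 0) :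
    x ∈ LieAlgebra.center ℝ 𝔤 :=
  (LieModule.mem_maxTrivSubmodule ℝ 𝔤 𝔤 x).2 fun y => by rw [← lie_skew, hx, neg_zero]

theorem lie_mem_center [IsTwoStepNilpotent 𝔤] (x y : 𝔤) : ⁅x, y⁆ ∈ LieAlgebra.center ℝ 𝔤 :=
  (LieModule.mem_maxTrivSubmodule ℝ 𝔤 𝔤 _).2 fun z => IsTwoStepNilpotent.lie_lie_eq_zero z x y

/-- The exterior derivative of a left-invariant 1-form, as a bilinear form. -/
def dOneBilin (θ : 𝔤 →ₗ[ℝ] ℝ) : LinearMap.BilinForm ℝ 𝔤 :=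
  LinearMap.mk₂ ℝ (dOne θ) (fun x y z => by simp [dOne, add_comm]) (fun c x y => by simp [dOne])
    (fun x y z => by simp [dOne, add_comm]) fun c x y => by simp [dOne]

theorem dOneBilin_apply (θ : 𝔤 →ₗ[ℝ] ℝ) (x y : 𝔤) : dOneBilin θ x y = -θ ⁅x, y⁆ := rfl

theorem dOneBilin_isAlt (θ : 𝔤 →ₗ[ℝ] ℝ) : (dOneBilin θ).IsAlt := fun x => by
  simp [dOneBilin_apply]

theorem dTwo_insertNth (B : LinearMap.BilinForm ℝ 𝔤) (x : 𝔤) (p : Fin 3) (w : Fin 2 → 𝔤) :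
    dTwo B (p.insertNth x w) = (-1) ^ (p : ℕ) * dTwo B (Fin.cons x w) := by
  have hx : ∀ y, ⁅y, x⁆ = -⁅x, y⁆ := fun y => (lie_skew y x).symm
  fin_cases p
  · simp
  · change -B ⁅w 0, x⁆ (w 1) + B ⁅w 0, w 1⁆ x - B ⁅x, w 1⁆ (w 0) =
      (-1) ^ 1 * (-B ⁅x, w 0⁆ (w 1) + B ⁅x, w 1⁆ (w 0) - B ⁅w 0, w 1⁆ x)
    rw [hx, map_neg, LinearMap.neg_apply]
    ring
  · change -B ⁅w 0, w 1⁆ x + B ⁅w 0, x⁆ (w 1) - B ⁅w 1, x⁆ (w 0) =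
      (-1) ^ 2 * (-B ⁅x, w 0⁆ (w 1) + B ⁅x, w 1⁆ (w 0) - B ⁅w 0, w 1⁆ x)
    rw [hx, hx, map_neg, map_neg, LinearMap.neg_apply, LinearMap.neg_apply]
    ring

end Centre

namespace HermitianStructure

variable {𝔤 : Type*} [LieRing 𝔤] [LieAlgebra ℝ 𝔤] {S : HermitianStructure 𝔤}

theorem dTwo_F_cons_neg_J {z : 𝔤} (hz : S.J z ∈ LieAlgebra.center ℝ 𝔤) :
    (fun w => dTwo S.F (Fin.cons (-S.J z) w)) = ofBilin (dOneBilin (S.g z)) := by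
  funext w
  change -S.F ⁅-S.J z, w 0⁆ (w 1) + S.F ⁅-S.J z, w 1⁆ (w 0) - S.F ⁅w 0, w 1⁆ (-S.J z) =
    -S.g z ⁅w 0, w 1⁆
  simp [F_apply, S.J_sq, S.g_symm z, lie_eq_zero_of_mem_center hz]

/-- The contraction of `dF ∧ F` with the central vector `-J z`. -/
theorem IsBalanced.wedge_dOneBilin (hF : S.IsBalanced) {z : 𝔤}
    (hz : S.J z ∈ LieAlgebra.center ℝ 𝔤) {f : Fin 4 → 𝔤} (hf : ∀ i, S.g z (f i) = 0) :
    wedge (ofBilin (dOneBilin (S.g z))) (ofBilin S.F) f = 0 := by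
  have hFz : ∀ i, S.F (f i) (S.J z) = 0 := fun i => by
    rw [F_apply, S.J_sq, map_neg, S.g_symm, hf, neg_zero]
  rw [← dTwo_F_cons_neg_J hz, ← wedge_three_two_cons (dTwo_insertNth _ _) fun p i => ?_]
  · rw [show wedge (dTwo S.F) (ofBilin S.F) = 0 from hF]
    rfl
  · fin_cases p
    · simp [ofBilin, hFz, S.F_swap (S.J z)]
    · change S.F (f i) (-S.J z) = 0
      rw [map_neg, hFz, neg_zero]

theorem IsBalanced.sum_lie_J_eq_zero (hF : S.IsBalanced) {z : 𝔤}
    (hz : S.J z ∈ LieAlgebra.center ℝ 𝔤) {f : Fin 2 → 𝔤} (hf : S.IsUnitary f)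
    (hfz : ∀ i, S.g z (f i) = 0) (hJz : ∀ i, S.g z (S.J (f i)) = 0) :
    S.g z (∑ i, ⁅f i, S.J (f i)⁆) = 0 := by
  have hwedge := hF.wedge_dOneBilin hz (f := ![f 0, S.J (f 0), f 1, S.J (f 1)])
    (by simp [Fin.forall_fin_succ, hfz, hJz])
  rw [wedge_two_two (dOneBilin_isAlt _) S.F_isAlt] at hwedge
  have hortho := hf.orthonormal
  have hJ := hf.g_J_eq_zero
  simp only [Fin.isValue, Matrix.cons_val_zero, Matrix.cons_val_one, dOneBilin_apply,
    Matrix.cons_val, F_apply, S.J_sq, map_neg, hortho, ↓reduceIte, mul_neg, mul_one, neg_neg,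
    S.g_J_left, hJ, neg_zero, mul_zero, sub_zero, zero_ne_one, add_zero] at hwedge
  rw [Fin.sum_univ_two, map_add]
  linarith

namespace IsAbelian

theorem lie_J_left (hab : S.IsAbelian) (x y : 𝔤) : ⁅S.J x, y⁆ = -⁅x, S.J y⁆ := by
  rw [← hab x, S.J_sq, lie_neg, neg_neg]

theorem J_mem_center (hab : S.IsAbelian) {x : 𝔤} (hx : x ∈ LieAlgebra.center ℝ 𝔤) :
    S.J x ∈ LieAlgebra.center ℝ 𝔤 :=
  mem_center_of_forall_lie_eq_zero fun y => by
    rw [hab.lie_J_left, lie_eq_zero_of_mem_center hx, neg_zero]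

end IsAbelian

section Centre

variable [Module.Finite ℝ 𝔤]

/-- The vectors `a`, `J a`, `c`, `J c` are central, so every bracket is a multiple of `⁅b, J b⁆`. -/
theorem IsAbelian.g_lie_eq_zero_of_g_lie_J_eq_zero (hab : S.IsAbelian)
    (hdim : Module.finrank ℝ 𝔤 = 6) {b a c : 𝔤} (hf : S.IsUnitary ![b, a, c])
    (ha : a ∈ LieAlgebra.center ℝ 𝔤) (hc : c ∈ LieAlgebra.center ℝ 𝔤) {z : 𝔤}
    (hz : S.g z ⁅b, S.J b⁆ = 0) (x y : 𝔤) : S.g z ⁅x, y⁆ = 0 := by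
  have hdecomp : ∀ x : 𝔤, ∃ (s t : ℝ) (w : 𝔤), w ∈ LieAlgebra.center ℝ 𝔤 ∧
      x = s • b + t • S.J b + w := fun x => by
    have hx := hf.eq_sum (W := ⊤) (x := x) (by simpa using hdim) (fun _ => trivial)
      (fun _ => trivial) trivial
    rw [Fin.sum_univ_three, add_assoc] at hx
    exact ⟨_, _, _, add_mem
      (add_mem (Submodule.smul_mem _ _ ha) (Submodule.smul_mem _ _ (hab.J_mem_center ha)))
      (add_mem (Submodule.smul_mem _ _ hc) (Submodule.smul_mem _ _ (hab.J_mem_center hc))), hx⟩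
  obtain ⟨s, t, w, hw, rfl⟩ := hdecomp x
  obtain ⟨s', t', w', hw', rfl⟩ := hdecomp y
  have hswap : ⁅S.J b, b⁆ = -⁅b, S.J b⁆ := (lie_skew _ _).symm
  simp only [lie_add, add_lie, smul_lie, lie_smul, lie_self, hswap,
    lie_eq_zero_of_mem_center hw, lie_eq_zero_of_mem_center_right hw', smul_zero, add_zero,
    zero_add, map_add, map_smul, map_neg, hz, neg_zero]

variable [IsTwoStepNilpotent 𝔤]

theorem IsBalanced.finrank_center (hF : S.IsBalanced) (hab : S.IsAbelian)
    (hdim : Module.finrank ℝ 𝔤 = 6) : Module.finrank ℝ (LieAlgebra.center ℝ 𝔤) = 2 := by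
  obtain ⟨x, y, hxy⟩ := IsTwoStepNilpotent.exists_lie_ne_zero (𝔤 := 𝔤)
  obtain ⟨t, -, hunit⟩ := S.exists_smul_unit hxy
  have hc : t • ⁅x, y⁆ ∈ LieAlgebra.center ℝ 𝔤 := Submodule.smul_mem _ t (lie_mem_center x y)
  refine le_antisymm (not_lt.1 fun hlt => ?_) ?_
  · obtain ⟨a, ha, hac⟩ := (IsUnitary.singleton hunit).exists_vecCons
      (W := (LieAlgebra.center ℝ 𝔤).toSubmodule) hlt
    obtain ⟨b, -, hbac⟩ := hac.exists_vecCons (W := ⊤) (by rw [finrank_top]; omega)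
    have hb := hF.sum_lie_J_eq_zero (hab.J_mem_center hc)
      (hbac.comp (Fin.castSucc_injective 2))
      (Fin.forall_fin_two.2 ⟨hbac.orthonormal 2 0, hbac.orthonormal 2 1⟩)
      (Fin.forall_fin_two.2 ⟨hbac.g_J_eq_zero 2 0, hbac.g_J_eq_zero 2 1⟩)
    rw [Fin.sum_univ_two] at hb
    change S.g _ (⁅b, S.J b⁆ + ⁅a, S.J a⁆) = 0 at hb
    rw [lie_eq_zero_of_mem_center ha, add_zero] at hb
    have hzero := hab.g_lie_eq_zero_of_g_lie_J_eq_zero hdim hbac ha hc hb x y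
    rw [map_smul, hzero, smul_zero] at hunit
    exact zero_ne_one hunit
  · exact (IsUnitary.singleton hunit).two_mul_card_le_finrank
      (W := (LieAlgebra.center ℝ 𝔤).toSubmodule)
      (by simpa using hc) (by simpa using hab.J_mem_center hc)

/-- By the balanced condition the left-hand side is orthogonal to `c` and to `J c`. -/
theorem IsBalanced.lie_J_add_lie_J (hF : S.IsBalanced) (hab : S.IsAbelian)
    (hcenter : Module.finrank ℝ (LieAlgebra.center ℝ 𝔤) = 2) {b a c : 𝔤}
    (hf : S.IsUnitary ![b, a, c]) (hc : c ∈ LieAlgebra.center ℝ 𝔤) :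
    ⁅b, S.J b⁆ + ⁅a, S.J a⁆ = 0 := by
  have hJc := hab.J_mem_center hc
  have hba := hf.comp (Fin.castSucc_injective 2)
  have hgc : S.g c (⁅b, S.J b⁆ + ⁅a, S.J a⁆) = 0 := by
    have h := hF.sum_lie_J_eq_zero hJc hba
      (Fin.forall_fin_two.2 ⟨hf.orthonormal 2 0, hf.orthonormal 2 1⟩)
      (Fin.forall_fin_two.2 ⟨hf.g_J_eq_zero 2 0, hf.g_J_eq_zero 2 1⟩)
    rwa [Fin.sum_univ_two] at h
  have hgJc : S.g (S.J c) (⁅b, S.J b⁆ + ⁅a, S.J a⁆) = 0 := by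
    have h := hF.sum_lie_J_eq_zero (hab.J_mem_center hJc) hba
      (fun i => by rw [S.g_symm]; exact hf.g_J_eq_zero i.castSucc 2)
      (fun i => by
        rw [S.g_J]; exact (hf.orthonormal 2 i.castSucc).trans (if_neg i.castSucc_lt_last.ne'))
    rwa [Fin.sum_univ_two] at h
  have hmem : ⁅b, S.J b⁆ + ⁅a, S.J a⁆ ∈ LieAlgebra.center ℝ 𝔤 :=
    add_mem (lie_mem_center _ _) (lie_mem_center _ _)
  have hunit : S.IsUnitary ![c] := .singleton (hf.orthonormal 2 2)
  rw [hunit.eq_sum (W := (LieAlgebra.center ℝ 𝔤).toSubmodule) hcenter (by simpa using hc)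
    (by simpa using hJc) hmem]
  simp [hgc, hgJc]

end Centre

end HermitianStructure

/-! ### Classification of the Lie algebras -/

section StructureConstants

theorem bijective_sum_smul {ι V : Type*} [Fintype ι] [AddCommGroup V] [Module ℝ V]
    [Module.Finite ℝ V] (hdim : Module.finrank ℝ V = Fintype.card ι) {v : ι → V}
    (hv : LinearIndependent ℝ v) :
    Function.Bijective fun x : ι → ℝ => ∑ i, x i • v i := by
  have hinj : Function.Injective (Fintype.linearCombination ℝ v) :=
    hv.fintypeLinearCombination_injective
  exact ⟨hinj, (LinearMap.injective_iff_surjective_of_finrank_eq_finrank (by simp [hdim])).1 hinj⟩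

variable {𝔤 : Type*} [LieRing 𝔤] [LieAlgebra ℝ 𝔤] [Module.Finite ℝ 𝔤] {v : Fin 6 → 𝔤}

theorem nonempty_lieEquiv_H3 (hdim : Module.finrank ℝ 𝔤 = 6) (hv : LinearIndependent ℝ v)
    (h4 : v 4 ∈ LieAlgebra.center ℝ 𝔤) (h5 : v 5 ∈ LieAlgebra.center ℝ 𝔤)
    (h01 : ⁅v 0, v 1⁆ = -v 5) (h23 : ⁅v 2, v 3⁆ = -v 5) (h02 : ⁅v 0, v 2⁆ = 0)
    (h03 : ⁅v 0, v 3⁆ = 0) (h12 : ⁅v 1, v 2⁆ = 0) (h13 : ⁅v 1, v 3⁆ = 0) :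
    Nonempty (𝔤 ≃ₗ⁅ℝ⁆ H3) := by
  have hneg : ∀ i j, ⁅v i, v j⁆ = -⁅v j, v i⁆ := fun i j => (lie_skew _ _).symm
  let T : H3 →ₗ⁅ℝ⁆ 𝔤 :=
    { toFun := fun x => ∑ i, x i • v i
      map_add' := fun x y => by
        simp only [H3.add_apply, add_smul, Finset.sum_add_distrib]
      map_smul' := fun r x => by
        simp only [H3.smul_apply, mul_smul, Finset.smul_sum, RingHom.id_apply]
      map_lie' := fun {x y} => by
        simp only [Fin.sum_univ_six, H3.lie_apply, Matrix.cons_val, add_lie, lie_add, smul_lie,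
          lie_smul, lie_self, lie_eq_zero_of_mem_center h4, lie_eq_zero_of_mem_center h5,
          lie_eq_zero_of_mem_center_right h4, lie_eq_zero_of_mem_center_right h5, hneg 1 0,
          hneg 2 0, hneg 3 0, hneg 2 1, hneg 3 1, hneg 3 2, h01, h23, h02, h03, h12, h13]
        module }
  exact ⟨(LieEquiv.ofBijective T (bijective_sum_smul (by simpa using hdim) hv)).symm⟩

theorem nonempty_lieEquiv_H5 (hdim : Module.finrank ℝ 𝔤 = 6) (hv : LinearIndependent ℝ v)
    (h4 : v 4 ∈ LieAlgebra.center ℝ 𝔤) (h5 : v 5 ∈ LieAlgebra.center ℝ 𝔤)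
    (h01 : ⁅v 0, v 1⁆ = 0) (h23 : ⁅v 2, v 3⁆ = 0) (h02 : ⁅v 0, v 2⁆ = -v 4)
    (h13 : ⁅v 1, v 3⁆ = v 4) (h03 : ⁅v 0, v 3⁆ = -v 5) (h12 : ⁅v 1, v 2⁆ = -v 5) :
    Nonempty (𝔤 ≃ₗ⁅ℝ⁆ H5) := by
  have hneg : ∀ i j, ⁅v i, v j⁆ = -⁅v j, v i⁆ := fun i j => (lie_skew _ _).symm
  let T : H5 →ₗ⁅ℝ⁆ 𝔤 :=
    { toFun := fun x => ∑ i, x i • v i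
      map_add' := fun x y => by
        simp only [H5.add_apply, add_smul, Finset.sum_add_distrib]
      map_smul' := fun r x => by
        simp only [H5.smul_apply, mul_smul, Finset.smul_sum, RingHom.id_apply]
      map_lie' := fun {x y} => by
        simp only [Fin.sum_univ_six, H5.lie_apply, Matrix.cons_val, add_lie, lie_add, smul_lie,
          lie_smul, lie_self, lie_eq_zero_of_mem_center h4, lie_eq_zero_of_mem_center h5,
          lie_eq_zero_of_mem_center_right h4, lie_eq_zero_of_mem_center_right h5, hneg 1 0,
          hneg 2 0, hneg 3 0, hneg 2 1, hneg 3 1, hneg 3 2, h01, h23, h02, h03, h12, h13]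
        module }
  exact ⟨(LieEquiv.ofBijective T (bijective_sum_smul (by simpa using hdim) hv)).symm⟩

end StructureConstants

section RightHanded

open Matrix

theorem exists_unit_mem_ker {ι W : Type*} [Fintype ι] [AddCommGroup W] [Module ℝ W]
    [Module.Finite ℝ W] (f : (ι → ℝ) →ₗ[ℝ] W) (hW : Module.finrank ℝ W < Fintype.card ι) :
    ∃ n : ι → ℝ, n ⬝ᵥ n = 1 ∧ f n = 0 := by
  obtain ⟨x, hx, hx0⟩ := Submodule.exists_mem_ne_zero_of_ne_bot
    (LinearMap.ker_ne_bot_of_finrank_lt (f := f) (by simpa using hW))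
  have hpos : 0 < x ⬝ᵥ x := dotProduct_self_star_pos_iff.2 hx0
  refine ⟨(√(x ⬝ᵥ x))⁻¹ • x, ?_, by rw [map_smul, LinearMap.mem_ker.1 hx, smul_zero]⟩
  rw [smul_dotProduct, dotProduct_smul, smul_eq_mul, smul_eq_mul, ← mul_assoc, ← mul_inv,
    Real.mul_self_sqrt hpos.le, inv_mul_cancel₀ hpos.ne']

/-- A positively oriented orthonormal basis of `ℝ³`, encoded by the fact that it multiplies under
the cross product as the imaginary units of the quaternions do. -/
structure IsRightHanded (n m k : Fin 3 → ℝ) : Prop where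
  dot_self : n ⬝ᵥ n = 1
  cross_fst_snd : n ⨯₃ m = k
  cross_snd_trd : m ⨯₃ k = n
  cross_trd_fst : k ⨯₃ n = m

theorem isRightHanded_cross {n k : Fin 3 → ℝ} (hn : n ⬝ᵥ n = 1) (hk : k ⬝ᵥ k = 1)
    (hnk : n ⬝ᵥ k = 0) : IsRightHanded n (k ⨯₃ n) k where
  dot_self := hn
  cross_fst_snd := by
    rw [cross_cross_eq_smul_sub_smul', hn, dotProduct_comm k, hnk, one_smul, zero_smul, sub_zero]
  cross_snd_trd := by
    rw [cross_cross_eq_smul_sub_smul, hk, hnk, one_smul, zero_smul, sub_zero]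
  cross_trd_fst := rfl

theorem exists_isRightHanded {n : Fin 3 → ℝ} (hn : n ⬝ᵥ n = 1) :
    ∃ m k, IsRightHanded n m k := by
  obtain ⟨k, hk, hnk⟩ := exists_unit_mem_ker (dotProductBilin ℝ ℝ n) (by simp)
  exact ⟨_, k, isRightHanded_cross hn hk hnk⟩

theorem IsRightHanded.linearIndependent {n m k : Fin 3 → ℝ} (h : IsRightHanded n m k) :
    LinearIndependent ℝ ![n, m, k] := by
  refine linearIndependent_rows_of_det_ne_zero (A := ![n, m, k]) ?_
  rw [← triple_product_eq_det, h.cross_snd_trd, h.dot_self]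
  exact one_ne_zero

theorem IsRightHanded.rotate {n m k : Fin 3 → ℝ} (h : IsRightHanded n m k) :
    IsRightHanded m k n where
  dot_self := by
    nth_rewrite 1 [← h.cross_trd_fst]
    rw [dotProduct_comm, ← triple_product_permutation, h.cross_snd_trd, h.dot_self]
  cross_fst_snd := h.cross_snd_trd
  cross_snd_trd := h.cross_trd_fst
  cross_trd_fst := h.cross_fst_snd

end RightHanded

section QuaternionicFrame

open Matrix

variable {𝔤 : Type*} [LieRing 𝔤] [LieAlgebra ℝ 𝔤]

/-- An identification `(s, n) ↦ s a + q n` of the quaternions `ℝ ⊕ ℝ³` with a complement of the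
centre, for which the bracket of two imaginary quaternions depends only on the imaginary part of
their product. Such a frame describes the Lie algebras with an Abelian balanced structure. -/
structure IsQuaternionicFrame (a : 𝔤) (q : (Fin 3 → ℝ) →ₗ[ℝ] 𝔤) : Prop where
  lie_map_map : ∀ n m, ⁅q n, q m⁆ = -⁅q (n ⨯₃ m), a⁆
  eq_zero_of_mem_center : ∀ (s : ℝ) (n : Fin 3 → ℝ),
    s • a + q n ∈ LieAlgebra.center ℝ 𝔤 → s = 0 ∧ n = 0
  exists_eq_add : ∀ x, ∃ (s : ℝ) (n : Fin 3 → ℝ),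
    ∃ w ∈ LieAlgebra.center ℝ 𝔤, x = s • a + q n + w

namespace IsQuaternionicFrame

variable {a : 𝔤} {q : (Fin 3 → ℝ) →ₗ[ℝ] 𝔤}

theorem linearIndependent (h : IsQuaternionicFrame a q) {n m k : Fin 3 → ℝ}
    (hnmk : LinearIndependent ℝ ![n, m, k]) {u w : LieAlgebra.center ℝ 𝔤}
    (huw : LinearIndependent ℝ ![u, w]) :
    LinearIndependent ℝ ![a, q n, q m, q k, (u : 𝔤), (w : 𝔤)] := by
  rw [Fintype.linearIndependent_iff] at hnmk ⊢
  rw [LinearIndependent.pair_iff] at huw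
  intro x hx
  simp only [Fin.sum_univ_six, Matrix.cons_val] at hx
  obtain ⟨h0, hn⟩ := h.eq_zero_of_mem_center (x 0) (x 1 • n + x 2 • m + x 3 • k) (by
    convert (-(x 4 • u + x 5 • w)).2 using 1
    change _ = -(x 4 • (u : 𝔤) + x 5 • (w : 𝔤))
    rw [eq_neg_iff_add_eq_zero, ← hx]
    simp only [map_add, map_smul]
    abel)
  have h123 := hnmk ![x 1, x 2, x 3] (by simpa [Fin.sum_univ_three] using hn)
  have h1 : x 1 = 0 := h123 0
  have h2 : x 2 = 0 := h123 1
  have h3 : x 3 = 0 := h123 2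
  obtain ⟨h4, h5⟩ := huw (x 4) (x 5)
    (Subtype.ext (by simpa [h0, h1, h2, h3] using hx))
  intro i
  fin_cases i <;> assumption

variable [IsTwoStepNilpotent 𝔤]

variable (a q) in
/-- The bracket of an imaginary quaternion with the real one. -/
def lieMap : (Fin 3 → ℝ) →ₗ[ℝ] LieAlgebra.center ℝ 𝔤 :=
  { toFun := fun n => ⟨⁅q n, a⁆, lie_mem_center _ _⟩
    map_add' := fun n m => Subtype.ext (by simp)
    map_smul' := fun s n => Subtype.ext (by simp) }

theorem coe_lieMap (n : Fin 3 → ℝ) : (lieMap a q n : 𝔤) = ⁅q n, a⁆ := rfl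

theorem lie_eq_neg_lieMap (n : Fin 3 → ℝ) : ⁅a, q n⁆ = -(lieMap a q n : 𝔤) := by
  rw [coe_lieMap, lie_skew]

theorem lie_map_map_eq_neg_lieMap (h : IsQuaternionicFrame a q) (n m : Fin 3 → ℝ) :
    ⁅q n, q m⁆ = -(lieMap a q (n ⨯₃ m) : 𝔤) :=
  h.lie_map_map n m

theorem lieMap_ne_zero (h : IsQuaternionicFrame a q) : lieMap a q ≠ 0 := by
  intro hzero
  have hq : ∀ n, ⁅q n, a⁆ = 0 := fun n => by rw [← coe_lieMap, hzero]; rfl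
  have ha : a ∈ LieAlgebra.center ℝ 𝔤 := mem_center_of_forall_lie_eq_zero fun y => by
    obtain ⟨s, n, w, hw, rfl⟩ := h.exists_eq_add y
    rw [lie_add, lie_add, lie_smul, lie_self, ← lie_skew, hq,
      lie_eq_zero_of_mem_center_right hw, smul_zero, neg_zero, add_zero, add_zero]
  exact one_ne_zero (h.eq_zero_of_mem_center 1 0 (by simpa using ha)).1

section Classification

variable [Module.Finite ℝ 𝔤]

theorem linearIndependent_lieMap {n m k : Fin 3 → ℝ}
    (hrank : Module.finrank ℝ (lieMap a q).range = 2) (hframe : IsRightHanded n m k)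
    (hn : lieMap a q n = 0) :
    LinearIndependent ℝ ![lieMap a q m, lieMap a q k] := by
  rw [linearIndependent_iff_card_le_finrank_span, Fintype.card_fin]
  change 2 ≤ _
  rw [← hrank]
  refine Submodule.finrank_mono ?_
  have htop : ⊤ ≤ Submodule.span ℝ (Set.range ![n, m, k]) :=
    (hframe.linearIndependent.span_eq_top_of_card_eq_finrank (by simp)).ge
  rw [LinearMap.range_eq_map]
  refine (Submodule.map_mono htop).trans ?_
  rw [Submodule.map_span, Submodule.span_le]
  rintro _ ⟨_, ⟨i, rfl⟩, rfl⟩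
  fin_cases i
  · simp [hn]
  · exact Submodule.subset_span ⟨0, rfl⟩
  · exact Submodule.subset_span ⟨1, rfl⟩

theorem nonempty_lieEquiv_H5 (h : IsQuaternionicFrame a q) (hdim : Module.finrank ℝ 𝔤 = 6)
    (hrank : Module.finrank ℝ (lieMap a q).range = 2) : Nonempty (𝔤 ≃ₗ⁅ℝ⁆ H5) := by
  obtain ⟨n, hn1, hn⟩ := exists_unit_mem_ker (lieMap a q).rangeRestrict (by simp [hrank])
  replace hn : lieMap a q n = 0 := congrArg Subtype.val hn
  obtain ⟨m, k, hf⟩ := exists_isRightHanded hn1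
  refine Nilmanifold.nonempty_lieEquiv_H5 hdim
    (h.linearIndependent hf.linearIndependent (linearIndependent_lieMap hrank hf hn))
    (lieMap a q m).2 (lieMap a q k).2 ?_ ?_ ?_ ?_ ?_ ?_ <;>
    simp only [Matrix.cons_val, lie_eq_neg_lieMap, h.lie_map_map_eq_neg_lieMap, hn,
      hf.cross_fst_snd, hf.cross_snd_trd, ← cross_anticomm k n, hf.cross_trd_fst, map_neg]
  all_goals simp

theorem nonempty_lieEquiv_H3 (h : IsQuaternionicFrame a q) (hdim : Module.finrank ℝ 𝔤 = 6)
    (hcenter : Module.finrank ℝ (LieAlgebra.center ℝ 𝔤) = 2)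
    (hrank : Module.finrank ℝ (lieMap a q).range = 1) : Nonempty (𝔤 ≃ₗ⁅ℝ⁆ H3) := by
  obtain ⟨n, hn1, hn⟩ := exists_unit_mem_ker (lieMap a q).rangeRestrict (by simp [hrank])
  obtain ⟨k, hk1, hk⟩ := exists_unit_mem_ker
    ((lieMap a q).rangeRestrict.prod (dotProductBilin ℝ ℝ n)) (by simp [hrank])
  obtain ⟨hk, hnk⟩ := Prod.mk.inj hk
  replace hn : lieMap a q n = 0 := congrArg Subtype.val hn
  replace hk : lieMap a q k = 0 := congrArg Subtype.val hk
  obtain ⟨m, hf⟩ : ∃ m, IsRightHanded n m k := ⟨_, isRightHanded_cross hn1 hk1 hnk⟩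
  have hm : lieMap a q m ≠ 0 := fun hm => h.lieMap_ne_zero <|
    LinearMap.ext_on_range (hf.linearIndependent.span_eq_top_of_card_eq_finrank (by simp))
      fun i => by fin_cases i <;> simp [hn, hm, hk]
  obtain ⟨w, hw⟩ := exists_linearIndependent_pair_of_one_lt_finrank (by rw [hcenter]; simp) hm
  refine Nilmanifold.nonempty_lieEquiv_H3 hdim
    (h.linearIndependent hf.rotate.linearIndependent (LinearIndependent.pair_symm_iff.1 hw))
    w.2 (lieMap a q m).2 ?_ ?_ ?_ ?_ ?_ ?_ <;>
    simp only [Matrix.cons_val, lie_eq_neg_lieMap, h.lie_map_map_eq_neg_lieMap, hn, hk,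
      hf.cross_snd_trd, hf.cross_trd_fst, ← cross_anticomm n m, hf.cross_fst_snd, map_neg]
  all_goals simp

theorem nonempty_lieEquiv (h : IsQuaternionicFrame a q) (hdim : Module.finrank ℝ 𝔤 = 6)
    (hcenter : Module.finrank ℝ (LieAlgebra.center ℝ 𝔤) = 2) :
    Nonempty (𝔤 ≃ₗ⁅ℝ⁆ H3) ∨ Nonempty (𝔤 ≃ₗ⁅ℝ⁆ H5) := by
  have hle : Module.finrank ℝ (lieMap a q).range ≤ 2 := hcenter ▸ Submodule.finrank_le _
  have hpos : 0 < Module.finrank ℝ (lieMap a q).range := by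
    rw [Module.finrank_pos_iff, Submodule.nontrivial_iff_ne_bot, Ne, LinearMap.range_eq_bot]
    exact h.lieMap_ne_zero
  obtain hrank | hrank : Module.finrank ℝ (lieMap a q).range = 1 ∨
    Module.finrank ℝ (lieMap a q).range = 2 := by omega
  exacts [.inl (h.nonempty_lieEquiv_H3 hdim hcenter hrank),
    .inr (h.nonempty_lieEquiv_H5 hdim hrank)]

end Classification

end IsQuaternionicFrame

namespace HermitianStructure

variable {S : HermitianStructure 𝔤}

theorem exists_isUnitary_mem_center (S : HermitianStructure 𝔤)
    (hdim : Module.finrank ℝ 𝔤 = 6) (hcenter : Module.finrank ℝ (LieAlgebra.center ℝ 𝔤) = 2) :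
    ∃ a b : 𝔤, ∃ c ∈ LieAlgebra.center ℝ 𝔤, S.IsUnitary ![a, b, c] := by
  have : Module.Finite ℝ 𝔤 := Module.finite_of_finrank_pos (by omega)
  have hempty : S.IsUnitary ![] := ⟨fun i => i.elim0, fun i => i.elim0⟩
  obtain ⟨c, hc, hfc⟩ := hempty.exists_vecCons
    (W := (LieAlgebra.center ℝ 𝔤).toSubmodule) (hcenter.symm ▸ two_pos)
  obtain ⟨b, -, hfb⟩ := hfc.exists_vecCons (W := ⊤) (by rw [finrank_top]; omega)
  obtain ⟨a, -, hfa⟩ := hfb.exists_vecCons (W := ⊤) (by rw [finrank_top]; omega)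
  exact ⟨a, b, c, hc, hfa⟩

variable {a b c : 𝔤}

theorem IsUnitary.g_eq_zero_of_mem_center (hf : S.IsUnitary ![a, b, c]) (hab : S.IsAbelian)
    (hcenter : Module.finrank ℝ (LieAlgebra.center ℝ 𝔤) = 2) (hc : c ∈ LieAlgebra.center ℝ 𝔤)
    {w : 𝔤} (hw : w ∈ LieAlgebra.center ℝ 𝔤) : ∀ x ∈ [a, S.J a, b, S.J b], S.g x w = 0 := by
  have : Module.Finite ℝ (LieAlgebra.center ℝ 𝔤) :=
    Module.finite_of_finrank_pos (hcenter ▸ two_pos)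
  have hunit : S.IsUnitary ![c] := .singleton (hf.orthonormal 2 2)
  have hac : S.g a c = 0 := hf.orthonormal 0 2
  have hbc : S.g b c = 0 := hf.orthonormal 1 2
  have haJc : S.g a (S.J c) = 0 := hf.g_J_eq_zero 0 2
  have hbJc : S.g b (S.J c) = 0 := hf.g_J_eq_zero 1 2
  rw [hunit.eq_sum (W := (LieAlgebra.center ℝ 𝔤).toSubmodule) hcenter (by simpa using hc)
    (by simpa using hab.J_mem_center hc) hw]
  simp [hac, hbc, haJc, hbJc, S.g_J_left, S.J_sq]

theorem IsUnitary.eq_zero_of_smul_add_mem_center (hf : S.IsUnitary ![a, b, c])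
    (hab : S.IsAbelian) (hcenter : Module.finrank ℝ (LieAlgebra.center ℝ 𝔤) = 2)
    (hc : c ∈ LieAlgebra.center ℝ 𝔤) {s : ℝ} {n : Fin 3 → ℝ}
    (hmem : s • a + (n 0 • S.J a + n 1 • b + n 2 • S.J b) ∈ LieAlgebra.center ℝ 𝔤) :
    s = 0 ∧ n = 0 := by
  have horth := hf.g_eq_zero_of_mem_center hab hcenter hc hmem
  have haa : S.g a a = 1 := hf.orthonormal 0 0
  have hbb : S.g b b = 1 := hf.orthonormal 1 1
  have hgab : S.g a b = 0 := hf.orthonormal 0 1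
  have hgba : S.g b a = 0 := hf.orthonormal 1 0
  have haJa : S.g a (S.J a) = 0 := hf.g_J_eq_zero 0 0
  have haJb : S.g a (S.J b) = 0 := hf.g_J_eq_zero 0 1
  have hbJa : S.g b (S.J a) = 0 := hf.g_J_eq_zero 1 0
  have hbJb : S.g b (S.J b) = 0 := hf.g_J_eq_zero 1 1
  have hs : s = 0 := by simpa [haa, hgab, haJa, haJb] using horth a (by simp)
  have h0 : n 0 = 0 := by
    simpa [haa, hgab, haJa, haJb, S.g_J_left, S.J_sq] using horth (S.J a) (by simp)
  have h1 : n 1 = 0 := by simpa [hbb, hgba, hbJa, hbJb] using horth b (by simp)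
  have h2 : n 2 = 0 := by
    simpa [hbb, hgba, hbJa, hbJb, S.g_J_left, S.J_sq] using horth (S.J b) (by simp)
  refine ⟨hs, ?_⟩
  ext i
  fin_cases i <;> assumption

theorem exists_isQuaternionicFrame [IsTwoStepNilpotent 𝔤] (hF : S.IsBalanced)
    (hab : S.IsAbelian) (hdim : Module.finrank ℝ 𝔤 = 6) :
    ∃ (a : 𝔤) (q : (Fin 3 → ℝ) →ₗ[ℝ] 𝔤), IsQuaternionicFrame a q := by
  have : Module.Finite ℝ 𝔤 := Module.finite_of_finrank_pos (by omega)
  have hcenter := hF.finrank_center hab hdim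
  obtain ⟨a, b, c, hc, hf⟩ := S.exists_isUnitary_mem_center hdim hcenter
  let q := Fintype.linearCombination ℝ ![S.J a, b, S.J b]
  have hq : ∀ n, q n = n 0 • S.J a + n 1 • b + n 2 • S.J b := fun n => by
    simp [q, Fintype.linearCombination_apply, Fin.sum_univ_three]
  refine ⟨-a, q, fun n m => ?_, fun s n hmem => ?_, fun x => ?_⟩
  · have hJaJb : ⁅S.J a, S.J b⁆ = ⁅a, b⁆ := hab a b
    have hJab : ⁅S.J a, b⁆ = -⁅a, S.J b⁆ := hab.lie_J_left a b
    have hbJb : ⁅b, S.J b⁆ = -⁅a, S.J a⁆ :=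
      eq_neg_of_add_eq_zero_right (hF.lie_J_add_lie_J hab hcenter hf hc)
    simp only [hq, lie_add, lie_smul, add_lie, smul_lie, lie_self, lie_neg, cross_apply,
      Matrix.cons_val, hJaJb, hJab, hbJb, ← lie_skew (S.J b) (S.J a), ← lie_skew b (S.J a),
      ← lie_skew (S.J b) b, ← lie_skew (S.J a) a, ← lie_skew b a, ← lie_skew (S.J b) a]
    module
  · rw [hq, smul_neg, ← neg_smul] at hmem
    exact (hf.eq_zero_of_smul_add_mem_center hab hcenter hc hmem).imp_left neg_eq_zero.1
  · refine ⟨-S.g a x, ![S.g (S.J a) x, S.g b x, S.g (S.J b) x],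
      S.g c x • c + S.g (S.J c) x • S.J c,
      add_mem (Submodule.smul_mem _ _ hc) (Submodule.smul_mem _ _ (hab.J_mem_center hc)), ?_⟩
    have hx := hf.eq_sum (W := ⊤) (by rw [finrank_top]; exact hdim) (fun _ => trivial)
      (fun _ => trivial) (x := x) trivial
    simp only [Fin.sum_univ_three, Matrix.cons_val] at hx
    conv_lhs => rw [hx]
    simp only [hq, Matrix.cons_val]
    module

end HermitianStructure

end QuaternionicFrame

/-! ### Bundles with anti-self-dual curvature -/

namespace AntiSelfDualTorusBundle

variable {𝔤 : Type*} [LieRing 𝔤] [LieAlgebra ℝ 𝔤] [IsTwoStepNilpotent 𝔤]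
  {Γ : Subgroup (SimplyConnectedGroup 𝔤)} {S : HermitianStructure 𝔤}

theorem bijective_prod (T : AntiSelfDualTorusBundle Γ S) (hdim : Module.finrank ℝ 𝔤 = 6) :
    Function.Bijective (T.P.prod (LinearMap.pi T.η)) := by
  have : Module.Finite ℝ 𝔤 := Module.finite_of_finrank_pos (by omega)
  have hinj : Function.Injective (T.P.prod (LinearMap.pi T.η)) := by
    refine (injective_iff_map_eq_zero _).2 fun x hx => ?_
    obtain ⟨hP, hη⟩ : T.P x = 0 ∧ (fun i => T.η i x) = 0 := Prod.mk_eq_zero.1 hx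
    have h0 : T.η 0 x = 0 := congrFun hη 0
    have h1 : T.η 1 x = 0 := congrFun hη 1
    by_contra hne
    exact (S.g_pos x hne).ne' (by rw [T.g_eq, hP, h0, h1]; simp)
  exact ⟨hinj, (LinearMap.injective_iff_surjective_of_finrank_eq_finrank (by simp [hdim])).1 hinj⟩

theorem P_J (T : AntiSelfDualTorusBundle Γ S) (hdim : Module.finrank ℝ 𝔤 = 6) (y : 𝔤) :
    T.P (S.J y) = T.base.J (T.P y) := by
  have hF : ∀ u, T.base.g u (T.P (S.J y)) = T.base.g u (T.base.J (T.P y)) := fun u => by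
    obtain ⟨x, hx⟩ := (T.bijective_prod hdim).2 (u, 0)
    obtain ⟨rfl, hη⟩ : T.P x = u ∧ (fun i => T.η i x) = 0 := Prod.mk.inj hx
    have h0 : T.η 0 x = 0 := congrFun hη 0
    have h1 : T.η 1 x = 0 := congrFun hη 1
    simpa [HermitianStructure.F_apply, T.g_eq, h0, h1] using T.F_eq x y
  by_contra hne
  refine (T.base.g_pos _ (sub_ne_zero.2 hne)).ne' ?_
  rw [map_sub (T.base.g _), hF, sub_self]

theorem isAbelian (T : AntiSelfDualTorusBundle Γ S) (hdim : Module.finrank ℝ 𝔤 = 6) :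
    S.IsAbelian := fun x y => by
  have hη : ∀ i, T.η i ⁅S.J x, S.J y⁆ = T.η i ⁅x, y⁆ := fun i => by
    rw [← neg_inj]
    change dOne (T.η i) _ _ = dOne (T.η i) _ _
    rw [T.dη_eq, T.dη_eq, T.P_J hdim, T.P_J hdim, (T.antiSelfDual i).map_J]
  exact (T.bijective_prod hdim).1 (Prod.ext ((T.P_lie _ _).trans (T.P_lie _ _).symm) (funext hη))

end AntiSelfDualTorusBundle

section Torus

variable {n : ℕ}

/-- The lattice `ℤⁿ ⊂ ℝⁿ`. -/
def intLattice (n : ℕ) : AddSubgroup (Fin n → ℝ) :=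
  ((Int.castAddHom ℝ).compLeft (Fin n)).range

theorem mem_intLattice {u : Fin n → ℝ} :
    u ∈ intLattice n ↔ ∃ z : Fin n → ℤ, (fun i => (z i : ℝ)) = u := Iff.rfl

theorem eq_zero_of_mem_intLattice_of_mem_ball {u₀ u w : Fin n → ℝ} (hw : w ∈ intLattice n)
    (hu : u ∈ Metric.ball u₀ (1 / 2)) (hwu : w + u ∈ Metric.ball u₀ (1 / 2)) : w = 0 := by
  obtain ⟨z, rfl⟩ := mem_intLattice.1 hw
  have hdist := (dist_triangle_right _ _ _).trans_lt (add_lt_add hwu hu)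
  rw [dist_eq_norm, add_sub_cancel_right, add_halves, pi_norm_lt_iff one_pos] at hdist
  funext i
  have hz : |(z i : ℝ)| < 1 := hdist i
  have hz0 : z i = 0 := Int.abs_lt_one_iff.1 (by exact_mod_cast hz)
  simp [hz0]

theorem toTorus_add (u v : Fin n → ℝ) : toTorus (u + v) = toTorus u + toTorus v := rfl

theorem toTorus_zero : toTorus (0 : Fin n → ℝ) = 0 := rfl

theorem toTorus_eq_iff {u v : Fin n → ℝ} : toTorus u = toTorus v ↔ v - u ∈ intLattice n := by
  have hcoord : ∀ i, (u i : UnitAddCircle) = v i ↔ ∃ z : ℤ, (z : ℝ) = v i - u i := fun i => by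
    simp only [eq_comm (a := (u i : UnitAddCircle)), ← sub_eq_zero (b := (u i : UnitAddCircle)),
      ← AddCircle.coe_sub, AddCircle.coe_eq_zero_iff, zsmul_one]
  simp only [mem_intLattice, funext_iff, toTorus, hcoord, Pi.sub_apply, Classical.skolem]

theorem toTorus_surjective : Function.Surjective (toTorus (n := n)) := fun t => by
  choose u hu using fun i => QuotientAddGroup.mk_surjective (t i)
  exact ⟨u, funext hu⟩

theorem continuous_toTorus : Continuous (toTorus (n := n)) :=
  continuous_pi fun i => (AddCircle.continuous_mk' 1).comp (continuous_apply i)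

theorem isOpenMap_toTorus : IsOpenMap (toTorus (n := n)) :=
  IsOpenMap.piMap (fun _ => QuotientAddGroup.isOpenMap_coe)
    (Filter.Eventually.of_forall fun _ => QuotientAddGroup.mk_surjective)

end Torus

theorem continuousOn_image_of_isOpenMap {X Y Z : Type*} [TopologicalSpace X]
    [TopologicalSpace Y] [TopologicalSpace Z] {p : X → Y} {q : X → Z} (hp : Continuous p)
    (hpo : IsOpenMap p) (hq : Continuous q) {W : Set X} (hW : IsOpen W) {f : Y → Z}
    (hf : ∀ a ∈ W, f (p a) = q a) : ContinuousOn f (p '' W) := by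
  rintro _ ⟨a, ha, rfl⟩
  refine ContinuousAt.continuousWithinAt ?_
  rw [ContinuousAt, ← hpo.map_nhds_eq hp.continuousAt, Filter.tendsto_map'_iff, hf a ha]
  exact hq.continuousAt.congr' (Filter.mem_of_superset (hW.mem_nhds ha) fun b hb => (hf b hb).symm)

theorem exists_openPartialHomeomorph_of_isOpenMap {X Y Z : Type*} [TopologicalSpace X]
    [TopologicalSpace Y] [TopologicalSpace Z] {p : X → Y} {q : X → Z} (hp : Continuous p)
    (hpo : IsOpenMap p) (hq : Continuous q) (hqo : IsOpenMap q) {W : Set X} (hW : IsOpen W)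
    (hne : W.Nonempty) (hpq : ∀ a ∈ W, ∀ b ∈ W, p a = p b ↔ q a = q b) :
    ∃ e : OpenPartialHomeomorph Y Z,
      e.source = p '' W ∧ e.target = q '' W ∧ ∀ a ∈ W, e (p a) = q a := by
  have : Nonempty X := hne.to_type
  have hf : ∀ a ∈ W, q (Function.invFunOn p W (p a)) = q a := fun a ha =>
    (hpq _ (Function.invFunOn_mem ⟨a, ha, rfl⟩) _ ha).1 (Function.invFunOn_eq ⟨a, ha, rfl⟩)
  have hg : ∀ a ∈ W, p (Function.invFunOn q W (q a)) = p a := fun a ha =>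
    (hpq _ (Function.invFunOn_mem ⟨a, ha, rfl⟩) _ ha).2 (Function.invFunOn_eq ⟨a, ha, rfl⟩)
  refine ⟨{
    toFun := fun y => q (Function.invFunOn p W y)
    invFun := fun z => p (Function.invFunOn q W z)
    source := p '' W
    target := q '' W
    map_source' := Set.forall_mem_image.2 fun a ha => ⟨a, ha, (hf a ha).symm⟩
    map_target' := Set.forall_mem_image.2 fun a ha => ⟨a, ha, (hg a ha).symm⟩
    left_inv' := Set.forall_mem_image.2 fun a ha => by rw [hf a ha, hg a ha]
    right_inv' := Set.forall_mem_image.2 fun a ha => by rw [hg a ha, hf a ha]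
    open_source := hpo W hW
    open_target := hqo W hW
    continuousOn_toFun := continuousOn_image_of_isOpenMap hp hpo hq hW hf
    continuousOn_invFun := continuousOn_image_of_isOpenMap hq hqo hp hW hg }, rfl, rfl, hf⟩

section Topology

variable {𝔤 : Type*} [LieRing 𝔤] [LieAlgebra ℝ 𝔤]

theorem continuous_linearMap_log {E : Type*} [AddCommGroup E] [Module ℝ E] [TopologicalSpace E]
    [ContinuousAdd E] [ContinuousSMul ℝ E] (f : 𝔤 →ₗ[ℝ] E) :
    Continuous fun a : SimplyConnectedGroup 𝔤 => f a.log := by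
  let _ : TopologicalSpace 𝔤 := moduleTopology ℝ 𝔤
  have : IsModuleTopology ℝ 𝔤 := ⟨rfl⟩
  exact (IsModuleTopology.continuous_of_linearMap f).comp continuous_induced_dom

theorem continuous_exp_linearMap {E : Type*} [AddCommGroup E] [Module ℝ E] [TopologicalSpace E]
    [IsModuleTopology ℝ E] (f : E →ₗ[ℝ] 𝔤) :
    Continuous fun u : E => (exp (f u) : SimplyConnectedGroup 𝔤) := by
  let _ : TopologicalSpace 𝔤 := moduleTopology ℝ 𝔤
  have : IsModuleTopology ℝ 𝔤 := ⟨rfl⟩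
  have : ContinuousAdd 𝔤 := IsModuleTopology.toContinuousAdd ℝ 𝔤
  exact continuous_induced_rng.2 (IsModuleTopology.continuous_of_linearMap f)

theorem continuous_const_mul_group (a : SimplyConnectedGroup 𝔤) :
    Continuous fun b : SimplyConnectedGroup 𝔤 => a * b := by
  let _ : TopologicalSpace 𝔤 := moduleTopology ℝ 𝔤
  have : IsModuleTopology ℝ 𝔤 := ⟨rfl⟩
  have : ContinuousAdd 𝔤 := IsModuleTopology.toContinuousAdd ℝ 𝔤
  refine continuous_induced_rng.2 ?_
  have h : (log ∘ fun b : SimplyConnectedGroup 𝔤 => a * b) = fun b => a.log +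
      (LinearMap.id + (2⁻¹ : ℝ) • LieAlgebra.ad ℝ 𝔤 a.log : 𝔤 →ₗ[ℝ] 𝔤) b.log := by
    funext b
    simp [add_assoc]
  rw [h]
  exact continuous_const.add (continuous_linearMap_log _)

variable [IsTwoStepNilpotent 𝔤]

theorem mk_eq_mk_iff {Γ : Subgroup (SimplyConnectedGroup 𝔤)} {a b : SimplyConnectedGroup 𝔤} :
    (Quotient.mk _ a : Space Γ) = Quotient.mk _ b ↔ ∃ γ ∈ Γ, b = γ * a := by
  rw [Quotient.eq, QuotientGroup.rightRel_apply]
  exact ⟨fun h => ⟨_, h, by simp⟩, by rintro ⟨γ, hγ, rfl⟩; simpa using hγ⟩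

theorem continuous_space_mk (Γ : Subgroup (SimplyConnectedGroup 𝔤)) :
    Continuous (Quotient.mk _ : SimplyConnectedGroup 𝔤 → Space Γ) :=
  continuous_quot_mk

theorem isOpenMap_space_mk (Γ : Subgroup (SimplyConnectedGroup 𝔤)) :
    IsOpenMap (Quotient.mk _ : SimplyConnectedGroup 𝔤 → Space Γ) := by
  have : ContinuousConstSMul Γ (SimplyConnectedGroup 𝔤) :=
    ⟨fun γ => continuous_const_mul_group (γ : SimplyConnectedGroup 𝔤)⟩
  exact isOpenMap_quotient_mk'_mul (Γ := Γ) (T := SimplyConnectedGroup 𝔤)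

end Topology

/-! ### Central splittings -/

section LogImage

variable {𝔤 : Type*} [LieRing 𝔤] [LieAlgebra ℝ 𝔤] [IsTwoStepNilpotent 𝔤]
  {E : Type*} [AddCommGroup E] [Module ℝ E]

/-- The image of a subgroup of `G` under the homomorphism from `G` to a vector space with
differential `f`. -/
def logImage (Γ : Subgroup (SimplyConnectedGroup 𝔤)) (f : 𝔤 →ₗ[ℝ] E)
    (hf : ∀ x y : 𝔤, f ⁅x, y⁆ = 0) : AddSubgroup E where
  carrier := {u | ∃ γ ∈ Γ, f γ.log = u}
  add_mem' := by
    rintro _ _ ⟨γ, hγ, rfl⟩ ⟨δ, hδ, rfl⟩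
    exact ⟨γ * δ, Γ.mul_mem hγ hδ, by simp [hf]⟩
  zero_mem' := ⟨1, Γ.one_mem, by simp⟩
  neg_mem' := by
    rintro _ ⟨γ, hγ, rfl⟩
    exact ⟨γ⁻¹, Γ.inv_mem hγ, by simp⟩

end LogImage

/-- A linear isomorphism `𝔤 ≃ ℝᵏ × ℝᵐ` for which the second factor is the centre. It provides the
coordinates in which the nilmanifold fibres over a torus. -/
structure CentralSplitting (𝔤 : Type*) [LieRing 𝔤] [LieAlgebra ℝ 𝔤] (k m : ℕ) where
  equiv : 𝔤 ≃ₗ[ℝ] (Fin k → ℝ) × (Fin m → ℝ)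
  mem_center_iff : ∀ x, x ∈ LieAlgebra.center ℝ 𝔤 ↔ (equiv x).1 = 0

namespace CentralSplitting

section Algebra

variable {𝔤 : Type*} [LieRing 𝔤] [LieAlgebra ℝ 𝔤] {k m : ℕ} (D : CentralSplitting 𝔤 k m)

/-- The projection `𝔤 → ℝᵏ` along the centre. -/
def P : 𝔤 →ₗ[ℝ] (Fin k → ℝ) := LinearMap.fst ℝ _ _ ∘ₗ D.equiv.toLinearMap

/-- The section `ℝᵏ → 𝔤` of `P`. -/
def σ : (Fin k → ℝ) →ₗ[ℝ] 𝔤 := D.equiv.symm.toLinearMap ∘ₗ LinearMap.inl ℝ _ _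

/-- The parametrization `ℝᵐ → 𝔤` of the centre. -/
def ξ : (Fin m → ℝ) →ₗ[ℝ] 𝔤 := D.equiv.symm.toLinearMap ∘ₗ LinearMap.inr ℝ _ _

/-- The central component `𝔤 → ℝᵐ`. -/
def ζ : 𝔤 →ₗ[ℝ] (Fin m → ℝ) := LinearMap.snd ℝ _ _ ∘ₗ D.equiv.toLinearMap

@[simp] theorem P_σ (u : Fin k → ℝ) : D.P (D.σ u) = u := by simp [P, σ]

@[simp] theorem P_ξ (s : Fin m → ℝ) : D.P (D.ξ s) = 0 := by simp [P, ξ]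

@[simp] theorem ζ_σ (u : Fin k → ℝ) : D.ζ (D.σ u) = 0 := by simp [ζ, σ]

@[simp] theorem ζ_ξ (s : Fin m → ℝ) : D.ζ (D.ξ s) = s := by simp [ζ, ξ]

theorem σ_P_add_ξ_ζ (x : 𝔤) : D.σ (D.P x) + D.ξ (D.ζ x) = x :=
  D.equiv.injective (by simp [P, σ, ξ, ζ])

theorem mem_center_iff_P_eq_zero {x : 𝔤} : x ∈ LieAlgebra.center ℝ 𝔤 ↔ D.P x = 0 :=
  D.mem_center_iff x

theorem ξ_mem_center (s : Fin m → ℝ) : D.ξ s ∈ LieAlgebra.center ℝ 𝔤 :=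
  D.mem_center_iff_P_eq_zero.2 (D.P_ξ s)

theorem ξ_ζ_of_P_eq_zero {x : 𝔤} (hx : D.P x = 0) : D.ξ (D.ζ x) = x := by
  simpa [hx] using D.σ_P_add_ξ_ζ x

@[simp] theorem σ_P_lie (x y : 𝔤) : ⁅D.σ (D.P x), y⁆ = ⁅x, y⁆ := by
  conv_rhs => rw [← D.σ_P_add_ξ_ζ x]
  rw [add_lie, lie_eq_zero_of_mem_center (D.ξ_mem_center _), add_zero]

@[simp] theorem lie_σ_P (x y : 𝔤) : ⁅x, D.σ (D.P y)⁆ = ⁅x, y⁆ := by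
  rw [← lie_skew, D.σ_P_lie, lie_skew]

theorem eq_zero_of_lie_σ_eq_zero {b : Set (Fin k → ℝ)} (hb : Submodule.span ℝ b = ⊤)
    {u : Fin k → ℝ} (hu : ∀ v ∈ b, ⁅D.σ u, D.σ v⁆ = 0) : u = 0 := by
  have had : LieAlgebra.ad ℝ 𝔤 (D.σ u) ∘ₗ D.σ = 0 := LinearMap.ext_on hb hu
  rw [← D.P_σ u, ← D.mem_center_iff_P_eq_zero]
  refine mem_center_of_forall_lie_eq_zero fun y => ?_
  rw [← D.lie_σ_P]
  exact LinearMap.congr_fun had (D.P y)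

/-- The form `dθ` on `𝔤 / 𝔷 = ℝᵏ`. For a connection form `θ` this is its curvature. -/
def curvature (θ : 𝔤 →ₗ[ℝ] ℝ) : LinearMap.BilinForm ℝ (Fin k → ℝ) :=
  (dOneBilin θ).compl₁₂ D.σ D.σ

theorem curvature_apply (θ : 𝔤 →ₗ[ℝ] ℝ) (u v : Fin k → ℝ) :
    D.curvature θ u v = dOne θ (D.σ u) (D.σ v) := rfl

theorem curvature_P (θ : 𝔤 →ₗ[ℝ] ℝ) (x y : 𝔤) :
    D.curvature θ (D.P x) (D.P y) = dOne θ x y := by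
  rw [curvature_apply, dOne, σ_P_lie, lie_σ_P, dOne]

theorem exp_ξ_mul (s : Fin m → ℝ) (a : SimplyConnectedGroup 𝔤) :
    exp (D.ξ s) * a = exp (a.log + D.ξ s) := by
  ext
  simp [lie_eq_zero_of_mem_center (D.ξ_mem_center s), add_comm]

theorem mul_exp_ξ (a : SimplyConnectedGroup 𝔤) (s : Fin m → ℝ) :
    a * exp (D.ξ s) = exp (a.log + D.ξ s) := by
  ext
  simp [lie_eq_zero_of_mem_center_right (D.ξ_mem_center s)]

/-- The splitting obtained by changes of coordinates in the two factors. -/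
def change (A : (Fin k → ℝ) ≃ₗ[ℝ] (Fin k → ℝ)) (C : (Fin m → ℝ) ≃ₗ[ℝ] (Fin m → ℝ)) :
    CentralSplitting 𝔤 k m where
  equiv := D.equiv.trans (A.prodCongr C)
  mem_center_iff x := by simp [D.mem_center_iff]

variable {A : (Fin k → ℝ) ≃ₗ[ℝ] (Fin k → ℝ)} {C : (Fin m → ℝ) ≃ₗ[ℝ] (Fin m → ℝ)}

theorem change_P (x : 𝔤) : (D.change A C).P x = A (D.P x) := rfl

theorem change_σ (u : Fin k → ℝ) : (D.change A C).σ u = D.σ (A.symm u) := by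
  simp [change, σ]

theorem change_ξ (s : Fin m → ℝ) : (D.change A C).ξ s = D.ξ (C.symm s) := by
  simp [change, ξ]

/-- The logarithm followed by the splitting. -/
def homeomorph : SimplyConnectedGroup 𝔤 ≃ₜ (Fin k → ℝ) × (Fin m → ℝ) where
  toFun a := (D.P a.log, D.ζ a.log)
  invFun x := exp (D.σ.coprod D.ξ x)
  left_inv a := by ext; simp [D.σ_P_add_ξ_ζ]
  right_inv x := by ext <;> simp
  continuous_toFun := (continuous_linearMap_log D.P).prodMk (continuous_linearMap_log D.ζ)
  continuous_invFun := continuous_exp_linearMap _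

/-- The coordinates `G → Tᵏ × Tᵐ` that induce the local trivializations. -/
def torusCoordinates (a : SimplyConnectedGroup 𝔤) : UnitAddTorus (Fin k) × UnitAddTorus (Fin m) :=
  (toTorus (D.P a.log), toTorus (D.ζ a.log))

theorem continuous_torusCoordinates : Continuous D.torusCoordinates :=
  (continuous_toTorus.prodMap continuous_toTorus).comp D.homeomorph.continuous

theorem isOpenMap_torusCoordinates : IsOpenMap D.torusCoordinates :=
  (isOpenMap_toTorus.prodMap isOpenMap_toTorus).comp D.homeomorph.isOpenMap

theorem image_torusCoordinates_preimage (B : Set (Fin k → ℝ)) :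
    D.torusCoordinates '' ((fun a => D.P a.log) ⁻¹' B) = (toTorus '' B) ×ˢ Set.univ := by
  ext ⟨x, y⟩
  constructor
  · rintro ⟨a, ha, hax⟩
    exact ⟨⟨_, ha, congrArg Prod.fst hax⟩, trivial⟩
  · rintro ⟨⟨u, hu, rfl⟩, -⟩
    obtain ⟨s, rfl⟩ := toTorus_surjective y
    exact ⟨exp (D.σ u + D.ξ s), by simpa using hu, by simp [torusCoordinates]⟩

variable [IsTwoStepNilpotent 𝔤]

@[simp] theorem P_lie (x y : 𝔤) : D.P ⁅x, y⁆ = 0 :=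
  D.mem_center_iff_P_eq_zero.1 (lie_mem_center x y)

theorem P_log_mul (a b : SimplyConnectedGroup 𝔤) :
    D.P (a * b).log = D.P a.log + D.P b.log := by
  simp

end Algebra

section Integral

variable {𝔤 : Type*} [LieRing 𝔤] [LieAlgebra ℝ 𝔤] [IsTwoStepNilpotent 𝔤] {k m : ℕ}

/-- The image of `Γ` in `ℝᵏ`. -/
def baseLattice (D : CentralSplitting 𝔤 k m) (Γ : Subgroup (SimplyConnectedGroup 𝔤)) :
    AddSubgroup (Fin k → ℝ) :=
  logImage Γ D.P D.P_lie

/-- The intersection of `Γ` with the centre, in the coordinates of the centre. -/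
def fibreLattice (D : CentralSplitting 𝔤 k m) (Γ : Subgroup (SimplyConnectedGroup 𝔤)) :
    AddSubgroup (Fin m → ℝ) where
  carrier := {s | exp (D.ξ s) ∈ Γ}
  add_mem' {s t} hs ht := by simpa [mul_exp_ξ] using Γ.mul_mem hs ht
  zero_mem' := show exp (D.ξ 0) ∈ Γ from (map_zero D.ξ).symm ▸ Γ.one_mem
  neg_mem' {s} hs := show exp (D.ξ (-s)) ∈ Γ from (map_neg D.ξ s).symm ▸ Γ.inv_mem hs

theorem mem_baseLattice_change {D : CentralSplitting 𝔤 k m}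
    {Γ : Subgroup (SimplyConnectedGroup 𝔤)} {A : (Fin k → ℝ) ≃ₗ[ℝ] (Fin k → ℝ)}
    {C : (Fin m → ℝ) ≃ₗ[ℝ] (Fin m → ℝ)} {u : Fin k → ℝ} :
    u ∈ (D.change A C).baseLattice Γ ↔ A.symm u ∈ D.baseLattice Γ := by
  refine exists_congr fun γ => and_congr_right fun _ => ?_
  rw [change_P, A.eq_symm_apply]

theorem mem_fibreLattice_change {D : CentralSplitting 𝔤 k m}
    {Γ : Subgroup (SimplyConnectedGroup 𝔤)} {A : (Fin k → ℝ) ≃ₗ[ℝ] (Fin k → ℝ)}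
    {C : (Fin m → ℝ) ≃ₗ[ℝ] (Fin m → ℝ)} {s : Fin m → ℝ} :
    s ∈ (D.change A C).fibreLattice Γ ↔ C.symm s ∈ D.fibreLattice Γ := by
  change exp ((D.change A C).ξ s) ∈ Γ ↔ _
  rw [change_ξ]
  rfl

/-- The splitting identifies the image of `Γ` in `𝔤 / 𝔷` with `ℤᵏ` and the intersection of `Γ` with
the centre with `ℤᵐ`. The nilmanifold is then a principal `Tᵐ`-bundle over `Tᵏ`. -/
structure IsIntegral (D : CentralSplitting 𝔤 k m) (Γ : Subgroup (SimplyConnectedGroup 𝔤)) :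
    Prop where
  baseLattice_eq : D.baseLattice Γ = intLattice k
  fibreLattice_eq : D.fibreLattice Γ = intLattice m

variable {D : CentralSplitting 𝔤 k m} {Γ : Subgroup (SimplyConnectedGroup 𝔤)}

theorem ζ_log_mem_fibreLattice {γ : SimplyConnectedGroup 𝔤} (hγ : γ ∈ Γ) (hP : D.P γ.log = 0) :
    D.ζ γ.log ∈ D.fibreLattice Γ :=
  show exp (D.ξ (D.ζ γ.log)) ∈ Γ from (D.ξ_ζ_of_P_eq_zero hP).symm ▸ hγ

theorem mk_eq_mk_iff_of_P_eq {a b : SimplyConnectedGroup 𝔤}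
    (hP : D.P a.log = D.P b.log) :
    (Quotient.mk _ a : Space Γ) = Quotient.mk _ b ↔
      D.ζ b.log - D.ζ a.log ∈ D.fibreLattice Γ := by
  rw [mk_eq_mk_iff]
  constructor
  · rintro ⟨γ, hγ, rfl⟩
    have hPγ : D.P γ.log = 0 := by simpa using hP
    have hγξ : γ = exp (D.ξ (D.ζ γ.log)) := by ext; exact (D.ξ_ζ_of_P_eq_zero hPγ).symm
    have hmem := ζ_log_mem_fibreLattice hγ hPγ
    rw [hγξ, exp_ξ_mul]
    simpa using hmem
  · intro hmem
    refine ⟨_, hmem, ?_⟩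
    rw [exp_ξ_mul]
    ext
    rw [← D.σ_P_add_ξ_ζ a.log, ← D.σ_P_add_ξ_ζ b.log, hP]
    simp [add_assoc]

/-- The bundle projection, induced by `P`. -/
def IsIntegral.proj (hD : D.IsIntegral Γ) : Space Γ → UnitAddTorus (Fin k) :=
  Quotient.lift (fun a => toTorus (D.P a.log)) fun a b hab => by
    obtain ⟨γ, hγ, rfl⟩ := mk_eq_mk_iff.1 (Quotient.sound hab)
    rw [toTorus_eq_iff, ← hD.baseLattice_eq, D.P_log_mul, add_sub_cancel_right]
    exact ⟨γ, hγ, rfl⟩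

theorem IsIntegral.proj_mk (hD : D.IsIntegral Γ) (a : SimplyConnectedGroup 𝔤) :
    hD.proj (Quotient.mk _ a) = toTorus (D.P a.log) := rfl

variable (D Γ) in
/-- The right translation by the central element `exp (ξ s)`. -/
def translate (s : Fin m → ℝ) : Space Γ → Space Γ :=
  Quotient.map (fun a => a * exp (D.ξ s)) fun a b hab => by
    obtain ⟨γ, hγ, rfl⟩ := mk_eq_mk_iff.1 (Quotient.sound hab)
    exact Quotient.exact (mk_eq_mk_iff.2 ⟨γ, hγ, mul_assoc _ _ _⟩)

variable (D Γ) in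
/-- The action of the structure group by right translations. The lift of `t` to `ℝᵐ` is arbitrary:
for an integral splitting the translation does not depend on it. -/
def act (t : UnitAddTorus (Fin m)) : Space Γ → Space Γ :=
  D.translate Γ (Function.surjInv toTorus_surjective t)

namespace IsIntegral

theorem act_mk (hD : D.IsIntegral Γ) (s : Fin m → ℝ) (a : SimplyConnectedGroup 𝔤) :
    D.act Γ (toTorus s) (Quotient.mk _ a) = Quotient.mk _ (a * exp (D.ξ s)) := by
  have hs := toTorus_eq_iff.1 (Function.surjInv_eq toTorus_surjective (toTorus s))
  rw [← hD.fibreLattice_eq] at hs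
  change Quotient.mk _ (a * exp (D.ξ (Function.surjInv toTorus_surjective (toTorus s)))) = _
  rw [mul_exp_ξ, mul_exp_ξ, mk_eq_mk_iff_of_P_eq (D := D) (by simp)]
  simpa using hs

theorem mk_eq_mk_iff_of_mem_ball (hD : D.IsIntegral Γ) {u₀ : Fin k → ℝ}
    {a b : SimplyConnectedGroup 𝔤} (ha : D.P a.log ∈ Metric.ball u₀ (1 / 2))
    (hb : D.P b.log ∈ Metric.ball u₀ (1 / 2)) :
    (Quotient.mk _ a : Space Γ) = Quotient.mk _ b ↔
      D.torusCoordinates a = D.torusCoordinates b := by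
  have hP : toTorus (D.P a.log) = toTorus (D.P b.log) → D.P a.log = D.P b.log := fun h =>
    (sub_eq_zero.1 (eq_zero_of_mem_intLattice_of_mem_ball (toTorus_eq_iff.1 h) ha
      (by rwa [sub_add_cancel]))).symm
  rw [torusCoordinates, torusCoordinates, Prod.mk.injEq]
  constructor
  · intro h
    have hbase : toTorus (D.P a.log) = toTorus (D.P b.log) := congrArg hD.proj h
    rw [mk_eq_mk_iff_of_P_eq (hP hbase), hD.fibreLattice_eq, ← toTorus_eq_iff] at h
    exact ⟨hbase, h⟩
  · rintro ⟨hbase, hfibre⟩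
    rwa [mk_eq_mk_iff_of_P_eq (hP hbase), hD.fibreLattice_eq, ← toTorus_eq_iff]

theorem image_mk_preimage (hD : D.IsIntegral Γ) (B : Set (Fin k → ℝ)) :
    (Quotient.mk _ '' ((fun a => D.P a.log) ⁻¹' B) : Set (Space Γ)) =
      hD.proj ⁻¹' (toTorus '' B) := by
  ext p
  induction p using Quotient.inductionOn with | _ a
  constructor
  · rintro ⟨b, hb, hba⟩
    rw [← hba]
    exact ⟨_, hb, rfl⟩
  · rintro ⟨u, hu, hua⟩
    obtain ⟨γ, hγ, hγu⟩ : u - D.P a.log ∈ D.baseLattice Γ := by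
      rw [hD.baseLattice_eq]
      exact toTorus_eq_iff.1 hua.symm
    refine ⟨γ * a, ?_, (mk_eq_mk_iff.2 ⟨γ, hγ, rfl⟩).symm⟩
    rwa [Set.mem_preimage, D.P_log_mul, hγu, sub_add_cancel]

theorem exists_trivialization (hD : D.IsIntegral Γ) (b : UnitAddTorus (Fin k)) :
    ∃ e : Bundle.Trivialization (UnitAddTorus (Fin m)) hD.proj, b ∈ e.baseSet ∧
      ∀ s, ∀ p ∈ e.source, (e (D.act Γ s p)).2 = s + (e p).2 := by
  obtain ⟨u₀, rfl⟩ := toTorus_surjective b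
  let B := Metric.ball u₀ (1 / 2)
  have hu₀ : u₀ ∈ B := Metric.mem_ball_self (by norm_num)
  obtain ⟨e, hsource, htarget, he⟩ := exists_openPartialHomeomorph_of_isOpenMap
    (continuous_space_mk Γ) (isOpenMap_space_mk Γ) D.continuous_torusCoordinates
    D.isOpenMap_torusCoordinates (Metric.isOpen_ball.preimage (continuous_linearMap_log D.P))
    ⟨exp (D.σ u₀), (D.P_σ u₀).symm ▸ hu₀⟩ fun a ha b hb => hD.mk_eq_mk_iff_of_mem_ball ha hb
  have hsurj : ∀ p ∈ e.source, ∃ a, D.P a.log ∈ B ∧ Quotient.mk _ a = p := by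
    rw [hsource]
    exact fun p hp => hp
  refine ⟨{
    toOpenPartialHomeomorph := e
    baseSet := toTorus '' B
    open_baseSet := isOpenMap_toTorus _ Metric.isOpen_ball
    source_eq := hsource.trans (hD.image_mk_preimage _)
    target_eq := htarget.trans (D.image_torusCoordinates_preimage _)
    proj_toFun := fun p hp => ?_ }, ⟨u₀, hu₀, rfl⟩, fun s p hp => ?_⟩
  · obtain ⟨a, ha, rfl⟩ := hsurj p hp
    exact congrArg Prod.fst (he a ha)
  · obtain ⟨a, ha, rfl⟩ := hsurj p hp
    obtain ⟨s, rfl⟩ := toTorus_surjective s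
    have has : D.P (a * exp (D.ξ s)).log ∈ B := by simpa using ha
    change (e _).2 = _ + (e _).2
    rw [hD.act_mk, he a ha, he _ has, mul_exp_ξ, torusCoordinates, torusCoordinates, ← toTorus_add]
    simp [add_comm]

theorem isPrincipalTorusBundle (hD : D.IsIntegral Γ) :
    IsPrincipalTorusBundle (D.act Γ) hD.proj where
  zero_act p := by
    induction p using Quotient.inductionOn with | _ a
    rw [← toTorus_zero, hD.act_mk, mul_exp_ξ, map_zero, add_zero]
  add_act s t p := by
    induction p using Quotient.inductionOn with | _ a
    obtain ⟨s, rfl⟩ := toTorus_surjective s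
    obtain ⟨t, rfl⟩ := toTorus_surjective t
    rw [← toTorus_add, hD.act_mk, hD.act_mk, hD.act_mk, mul_exp_ξ, mul_exp_ξ, mul_exp_ξ,
      map_add, add_assoc, add_comm (D.ξ t)]
  proj_act s p := by
    induction p using Quotient.inductionOn with | _ a
    obtain ⟨s, rfl⟩ := toTorus_surjective s
    rw [hD.act_mk, hD.proj_mk, hD.proj_mk, mul_exp_ξ]
    simp
  exists_trivialization := hD.exists_trivialization

end IsIntegral

end Integral

end CentralSplitting

/-! ### Lattices -/

section ZLattice

variable {E : Type*} [NormedAddCommGroup E] [NormedSpace ℝ E] [FiniteDimensional ℝ E]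

theorem exists_linearMap_extend_zlattice {F : Type*} [AddCommGroup F] [Module ℝ F]
    (L : Submodule ℤ E) [DiscreteTopology L] [IsZLattice ℝ L] (h : L →+ F) :
    ∃ μ : E →ₗ[ℝ] F, ∀ u : L, μ u = h u := by
  let b := Module.Free.chooseBasis ℤ L
  let μ := (b.ofZLatticeBasis ℝ L).constr ℝ fun i => h (b i)
  refine ⟨μ, fun u => ?_⟩
  have hμ : (μ.restrictScalars ℤ).comp L.subtype = h.toIntLinearMap := b.ext fun i => by
    change μ (b i) = h (b i)
    rw [← b.ofZLatticeBasis_apply ℝ L, Module.Basis.constr_basis]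
  exact LinearMap.congr_fun hμ u

theorem exists_linearEquiv_mem_intLattice {n : ℕ} (L : AddSubgroup (Fin n → ℝ))
    [DiscreteTopology L] (hL : Submodule.span ℝ (L : Set (Fin n → ℝ)) = ⊤) :
    ∃ A : (Fin n → ℝ) ≃ₗ[ℝ] (Fin n → ℝ), ∀ u, u ∈ L ↔ A u ∈ intLattice n := by
  let L' : Submodule ℤ (Fin n → ℝ) := L.toIntSubmodule
  have : DiscreteTopology L' := ‹DiscreteTopology L›
  have : IsZLattice ℝ L' := ⟨hL⟩
  let b := IsZLattice.basis L'
  refine ⟨(b.ofZLatticeBasis ℝ L').equivFun, fun u => ⟨fun hu => ?_, fun hu => ?_⟩⟩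
  · exact mem_intLattice.2
      ⟨b.repr ⟨u, hu⟩, funext fun i => (b.ofZLatticeBasis_repr_apply ℝ L' ⟨u, hu⟩ i).symm⟩
  · obtain ⟨z, hz⟩ := mem_intLattice.1 hu
    change u ∈ L'
    rw [← (b.ofZLatticeBasis ℝ L').sum_equivFun u, ← hz]
    refine sum_mem fun i _ => ?_
    rw [Int.cast_smul_eq_zsmul, b.ofZLatticeBasis_apply ℝ L']
    exact L'.smul_mem _ (b i).2

end ZLattice

section Lattice

variable {𝔤 : Type*} [LieRing 𝔤] [LieAlgebra ℝ 𝔤] [IsTwoStepNilpotent 𝔤]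
  {Γ : Subgroup (SimplyConnectedGroup 𝔤)}

theorem exp_lie_mem {γ δ : SimplyConnectedGroup 𝔤} (hγ : γ ∈ Γ) (hδ : δ ∈ Γ) :
    exp ⁅γ.log, δ.log⁆ ∈ Γ := by
  have hlie (x y z : 𝔤) : ⁅⁅x, y⁆, z⁆ = 0 := lie_eq_zero_of_mem_center (lie_mem_center x y) z
  have hcomm : exp ⁅γ.log, δ.log⁆ = γ * δ * γ⁻¹ * δ⁻¹ := by
    ext
    simp only [log_mul, log_inv, add_lie, lie_neg, neg_lie, smul_lie, hlie, lie_self, zero_lie,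
      ← lie_skew δ.log γ.log]
    module
  rw [hcomm]
  exact Γ.mul_mem (Γ.mul_mem (Γ.mul_mem hγ hδ) (Γ.inv_mem hγ)) (Γ.inv_mem hδ)

namespace IsLattice

/-- The form descends to a continuous, hence bounded, function on the compact quotient. -/
theorem linearMap_eq_zero (hΓ : IsLattice Γ) {f : 𝔤 →ₗ[ℝ] ℝ}
    (hlie : ∀ x y : 𝔤, f ⁅x, y⁆ = 0) (hf : ∀ γ ∈ Γ, f γ.log = 0) : f = 0 := by
  have := hΓ.cocompact
  let F : Space Γ → ℝ := Quotient.lift (fun a => f a.log) fun a b hab => by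
    obtain ⟨γ, hγ, rfl⟩ := mk_eq_mk_iff.1 (Quotient.sound hab)
    simp [hlie, hf γ hγ]
  have hF : Continuous F := (continuous_linearMap_log f).quotient_lift _
  obtain ⟨M, hM⟩ := (isCompact_range hF).bddAbove
  ext x
  by_contra hx
  have hx : f x ≠ 0 := hx
  have hle : f (((M + 1) / f x) • x) ≤ M := hM ⟨Quotient.mk _ (exp (((M + 1) / f x) • x)), rfl⟩
  rw [map_smul, smul_eq_mul, div_mul_cancel₀ _ hx] at hle
  linarith

theorem span_logImage (hΓ : IsLattice Γ) {E : Type*} [AddCommGroup E] [Module ℝ E]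
    {f : 𝔤 →ₗ[ℝ] E} (hf : ∀ x y : 𝔤, f ⁅x, y⁆ = 0) (hsurj : Function.Surjective f) :
    Submodule.span ℝ (logImage Γ f hf : Set E) = ⊤ := by
  by_contra hne
  obtain ⟨θ, hθ0, hθ⟩ := Submodule.exists_le_ker_of_lt_top _ (lt_top_iff_ne_top.2 hne)
  have hθf : θ ∘ₗ f = 0 := hΓ.linearMap_eq_zero (fun x y => by simp [hf]) fun γ hγ =>
    hθ (Submodule.subset_span ⟨γ, hγ, rfl⟩)
  exact hθ0 (LinearMap.ext fun u => by
    obtain ⟨x, rfl⟩ := hsurj u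
    exact LinearMap.congr_fun hθf x)

end IsLattice

end Lattice

namespace CentralSplitting

variable {𝔤 : Type*} [LieRing 𝔤] [LieAlgebra ℝ 𝔤] [IsTwoStepNilpotent 𝔤] {k m : ℕ}
  (D : CentralSplitting 𝔤 k m) {Γ : Subgroup (SimplyConnectedGroup 𝔤)}

theorem span_baseLattice (hΓ : IsLattice Γ) :
    Submodule.span ℝ (D.baseLattice Γ : Set (Fin k → ℝ)) = ⊤ :=
  hΓ.span_logImage D.P_lie fun u => ⟨D.σ u, D.P_σ u⟩

theorem discreteTopology_fibreLattice (hΓ : IsLattice Γ) :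
    DiscreteTopology (D.fibreLattice Γ) := by
  have := hΓ.discrete
  refine DiscreteTopology.of_continuous_injective
    (f := fun s : D.fibreLattice Γ => (⟨exp (D.ξ s), s.2⟩ : Γ))
    (((continuous_exp_linearMap D.ξ).comp continuous_subtype_val).subtype_mk _) fun s t hst => ?_
  have hξ : D.ξ s = D.ξ t := congrArg (fun γ : Γ => γ.1.log) hst
  ext1
  rw [← D.ζ_ξ s, hξ, D.ζ_ξ]

variable {D} in
theorem exp_lie_σ_mem {u v : Fin k → ℝ} (hu : u ∈ D.baseLattice Γ) (hv : v ∈ D.baseLattice Γ) :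
    exp ⁅D.σ u, D.σ v⁆ ∈ Γ := by
  obtain ⟨γ, hγ, rfl⟩ := hu
  obtain ⟨δ, hδ, rfl⟩ := hv
  rw [σ_P_lie, lie_σ_P]
  exact exp_lie_mem hγ hδ

/-- The commutators with finitely many elements of `Γ` that span modulo the centre embed the image
of `Γ` in a finite power of the discrete group `Γ`. -/
theorem discreteTopology_baseLattice (hΓ : IsLattice Γ) :
    DiscreteTopology (D.baseLattice Γ) := by
  have := hΓ.discrete
  obtain ⟨b, hb, hspan, hli⟩ := exists_linearIndependent ℝ (D.baseLattice Γ : Set (Fin k → ℝ))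
  rw [D.span_baseLattice hΓ] at hspan
  have : Finite b := hli.setFinite
  refine DiscreteTopology.of_continuous_injective
    (f := fun (u : D.baseLattice Γ) (v : b) => (⟨_, exp_lie_σ_mem u.2 (hb v.2)⟩ : Γ))
    (continuous_pi fun v => ?_) fun u u' huu' => ?_
  · have hcont := continuous_exp_linearMap (-(LieAlgebra.ad ℝ 𝔤 (D.σ v)) ∘ₗ D.σ)
    simp only [LinearMap.comp_apply, LinearMap.neg_apply, LieAlgebra.ad_apply, lie_skew] at hcont
    exact (hcont.comp continuous_subtype_val).subtype_mk _
  · ext1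
    refine sub_eq_zero.1 (D.eq_zero_of_lie_σ_eq_zero hspan fun v hv => ?_)
    rw [map_sub, sub_lie, sub_eq_zero]
    exact congrArg log (congrArg Subtype.val (congrFun huu' ⟨v, hv⟩))

theorem ζ_lie_eq_zero (hΓ : IsLattice Γ) {f : (Fin m → ℝ) →ₗ[ℝ] ℝ}
    (hf : ∀ s ∈ D.fibreLattice Γ, f s = 0) (x y : 𝔤) : f (D.ζ ⁅x, y⁆) = 0 := by
  have hcurv : D.curvature (f ∘ₗ D.ζ) = 0 :=
    LinearMap.ext_on (D.span_baseLattice hΓ) fun u hu =>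
      LinearMap.ext_on (D.span_baseLattice hΓ) fun v hv =>
        neg_eq_zero.2 (hf _ (ζ_log_mem_fibreLattice (exp_lie_σ_mem hu hv) (D.P_lie _ _)))
  have hxy := D.curvature_P (f ∘ₗ D.ζ) x y
  rw [hcurv] at hxy
  exact neg_eq_zero.1 hxy.symm

theorem exists_linearMap_ζ_log_eq (hΓ : IsLattice Γ) {f : (Fin m → ℝ) →ₗ[ℝ] ℝ}
    (hf : ∀ s ∈ D.fibreLattice Γ, f s = 0) :
    ∃ μ : (Fin k → ℝ) →ₗ[ℝ] ℝ, ∀ γ ∈ Γ, f (D.ζ γ.log) = μ (D.P γ.log) := by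
  have hlie := D.ζ_lie_eq_zero hΓ hf
  have hwell : ∀ γ ∈ Γ, ∀ δ ∈ Γ, D.P γ.log = D.P δ.log → f (D.ζ γ.log) = f (D.ζ δ.log) := by
    intro γ hγ δ hδ hP
    have hmem := hf _ (ζ_log_mem_fibreLattice (D := D) (Γ.mul_mem hγ (Γ.inv_mem hδ))
      (by rw [P_log_mul, hP, log_inv, map_neg, add_neg_cancel]))
    simpa [hlie, ← sub_eq_add_neg, sub_eq_zero] using hmem
  let L := (D.baseLattice Γ).toIntSubmodule
  have : DiscreteTopology L := D.discreteTopology_baseLattice hΓ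
  have : IsZLattice ℝ L := ⟨D.span_baseLattice hΓ⟩
  choose γ hγ hγP using fun u : L => u.2
  obtain ⟨μ, hμ⟩ := exists_linearMap_extend_zlattice L
    (AddMonoidHom.mk' (fun u => f (D.ζ (γ u).log)) fun u v => by
      rw [hwell _ (hγ _) _ (Γ.mul_mem (hγ u) (hγ v)) (by rw [P_log_mul, hγP, hγP, hγP]; rfl)]
      simp [hlie])
  exact ⟨μ, fun δ hδ => (hwell δ hδ _ (hγ _) (hγP ⟨_, δ, hδ, rfl⟩).symm).trans (hμ _).symm⟩

/-- If `f` vanishes on the lattice of the fibre, then `f ∘ ζ` is a homomorphism on `G` that factors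
through the base on `Γ`, hence on `G`. -/
theorem span_fibreLattice (hΓ : IsLattice Γ) :
    Submodule.span ℝ (D.fibreLattice Γ : Set (Fin m → ℝ)) = ⊤ := by
  by_contra hne
  obtain ⟨f, hf0, hf⟩ := Submodule.exists_le_ker_of_lt_top _ (lt_top_iff_ne_top.2 hne)
  have hfΓ : ∀ s ∈ D.fibreLattice Γ, f s = 0 := fun s hs => hf (Submodule.subset_span hs)
  obtain ⟨μ, hμ⟩ := D.exists_linearMap_ζ_log_eq hΓ hfΓ
  have hzero : f ∘ₗ D.ζ - μ ∘ₗ D.P = 0 := hΓ.linearMap_eq_zero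
    (fun x y => by simp [D.ζ_lie_eq_zero hΓ hfΓ]) fun γ hγ => sub_eq_zero.2 (hμ γ hγ)
  refine hf0 (LinearMap.ext fun s => ?_)
  simpa using LinearMap.congr_fun hzero (D.ξ s)

theorem exists_isIntegral_change (hΓ : IsLattice Γ) : ∃ A C, (D.change A C).IsIntegral Γ := by
  have := D.discreteTopology_baseLattice hΓ
  have := D.discreteTopology_fibreLattice hΓ
  obtain ⟨A, hA⟩ := exists_linearEquiv_mem_intLattice _ (D.span_baseLattice hΓ)
  obtain ⟨C, hC⟩ := exists_linearEquiv_mem_intLattice _ (D.span_fibreLattice hΓ)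
  refine ⟨A, C, AddSubgroup.ext fun u => ?_, AddSubgroup.ext fun s => ?_⟩
  · rw [mem_baseLattice_change, hA, A.apply_symm_apply]
  · rw [mem_fibreLattice_change, hC, C.apply_symm_apply]

end CentralSplitting

/-! ### The bundle of an Abelian balanced structure -/

namespace HermitianStructure

theorem isCompl_orthogonal {V : Type*} [AddCommGroup V] [Module ℝ V] [Module.Finite ℝ V]
    (S : HermitianStructure V) (W : Submodule ℝ V) : IsCompl (S.g.orthogonal W) W := by
  have hrefl : S.g.IsRefl := fun x y h => by rw [S.g_symm, h]
  refine (LinearMap.BilinForm.isCompl_orthogonal_of_restrict_nondegenerate hrefl ?_).symm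
  have hreflW : (S.g.restrict W).IsRefl := fun x y h => hrefl x y h
  refine hreflW.nondegenerate_iff_separatingLeft.2 fun x hx => ?_
  by_contra hx0
  exact (S.g_pos x fun h => hx0 (Subtype.ext h)).ne' (hx x)

section Plane

variable {V : Type*} [AddCommGroup V] [Module ℝ V] {S : HermitianStructure V}
  {W : Submodule ℝ V} {c w : V}

theorem eq_smul_add_smul_of_mem (hW : Module.finrank ℝ W = 2) (hc : S.g c c = 1) (hcW : c ∈ W)
    (hJcW : S.J c ∈ W) (hw : w ∈ W) : w = S.g c w • c + S.g (S.J c) w • S.J c := by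
  have : Module.Finite ℝ W := Module.finite_of_finrank_pos (hW ▸ two_pos)
  simpa using (IsUnitary.singleton hc).eq_sum (W := W) hW (by simpa using hcW)
    (by simpa using hJcW) hw

theorem g_eq_of_mem (hW : Module.finrank ℝ W = 2) (hc : S.g c c = 1) (hcW : c ∈ W)
    (hJcW : S.J c ∈ W) (x : V) (hw : w ∈ W) :
    S.g x w = S.g (S.J c) x * S.g (S.J c) w + S.g c x * S.g c w := by
  conv_lhs => rw [eq_smul_add_smul_of_mem hW hc hcW hJcW hw]
  rw [map_add, map_smul, map_smul, S.g_symm x c, S.g_symm x (S.J c), smul_eq_mul, smul_eq_mul]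
  ring

theorem F_eq_of_mem (hW : Module.finrank ℝ W = 2) (hc : S.g c c = 1) (hcW : c ∈ W)
    (hJcW : S.J c ∈ W) (x : V) (hw : w ∈ W) :
    S.F x w = S.g (S.J c) x * S.g c w - S.g c x * S.g (S.J c) w := by
  conv_lhs => rw [F_apply, eq_smul_add_smul_of_mem hW hc hcW hJcW hw]
  rw [map_add, map_smul, map_smul, S.J_sq, map_add, map_smul, map_smul, map_neg, S.g_symm x c,
    S.g_symm x (S.J c), smul_eq_mul, smul_eq_mul]
  ring

end Plane

end HermitianStructure

namespace CentralSplitting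

variable {𝔤 : Type*} [LieRing 𝔤] [LieAlgebra ℝ 𝔤] {k m : ℕ}

/-- The two factors of the splitting are orthogonal for the metric of `S`. -/
def IsOrthogonal (D : CentralSplitting 𝔤 k m) (S : HermitianStructure 𝔤) : Prop :=
  ∀ u, ∀ z ∈ LieAlgebra.center ℝ 𝔤, S.g (D.σ u) z = 0

theorem exists_isOrthogonal [Module.Finite ℝ 𝔤] (S : HermitianStructure 𝔤)
    (hdim : Module.finrank ℝ 𝔤 = k + m)
    (hcenter : Module.finrank ℝ (LieAlgebra.center ℝ 𝔤) = m) :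
    ∃ D : CentralSplitting 𝔤 k m, D.IsOrthogonal S := by
  let Z : Submodule ℝ 𝔤 := (LieAlgebra.center ℝ 𝔤).toSubmodule
  have hcompl := S.isCompl_orthogonal Z
  have hZ : Module.finrank ℝ Z = m := hcenter
  have horth : Module.finrank ℝ (S.g.orthogonal Z) = k := by
    have := Submodule.finrank_add_eq_of_isCompl hcompl
    omega
  let e : S.g.orthogonal Z ≃ₗ[ℝ] (Fin k → ℝ) := .ofFinrankEq _ _ (by simpa using horth)
  let e' : Z ≃ₗ[ℝ] (Fin m → ℝ) := .ofFinrankEq _ _ (by simpa using hZ)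
  let E := Submodule.prodEquivOfIsCompl _ _ hcompl
  refine ⟨⟨E.symm.trans (e.prodCongr e'), fun x => ?_⟩, fun u z hz => ?_⟩
  · change x ∈ Z ↔ e (E.symm x).1 = 0
    rw [e.map_eq_zero_iff, Submodule.prodEquivOfIsCompl_symm_apply_fst_eq_zero]
  · have hσ : S.g z (E (e.symm u, e'.symm 0)) = 0 := by
      rw [map_zero]
      simpa [E] using (e.symm u).2 z hz
    rwa [S.g_symm]

variable {D : CentralSplitting 𝔤 k m} {S : HermitianStructure 𝔤}

namespace IsOrthogonal

theorem change (hD : D.IsOrthogonal S) (A : (Fin k → ℝ) ≃ₗ[ℝ] (Fin k → ℝ))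
    (C : (Fin m → ℝ) ≃ₗ[ℝ] (Fin m → ℝ)) : (D.change A C).IsOrthogonal S := fun u z hz => by
  rw [change_σ]
  exact hD _ z hz

theorem g_σ (hD : D.IsOrthogonal S) {z : 𝔤} (hz : z ∈ LieAlgebra.center ℝ 𝔤) (u : Fin k → ℝ) :
    S.g z (D.σ u) = 0 := by
  rw [S.g_symm, hD u z hz]

theorem g_ξ_ζ (hD : D.IsOrthogonal S) {z : 𝔤} (hz : z ∈ LieAlgebra.center ℝ 𝔤) (x : 𝔤) :
    S.g z (D.ξ (D.ζ x)) = S.g z x := by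
  conv_rhs => rw [← D.σ_P_add_ξ_ζ x, map_add, hD.g_σ hz, zero_add]

theorem σ_P_of_orthogonal (hD : D.IsOrthogonal S) {x : 𝔤}
    (hx : ∀ z ∈ LieAlgebra.center ℝ 𝔤, S.g z x = 0) : D.σ (D.P x) = x := by
  have hξζ : D.ξ (D.ζ x) = 0 := by
    by_contra hne
    refine (S.g_pos _ hne).ne' ?_
    rw [hD.g_ξ_ζ (D.ξ_mem_center _), hx _ (D.ξ_mem_center _)]
  simpa [hξζ] using D.σ_P_add_ξ_ζ x

theorem g_eq (hD : D.IsOrthogonal S) (x y : 𝔤) :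
    S.g x y = S.g (D.σ (D.P x)) (D.σ (D.P y)) + S.g (D.ξ (D.ζ x)) (D.ξ (D.ζ y)) := by
  conv_lhs => rw [← D.σ_P_add_ξ_ζ x, ← D.σ_P_add_ξ_ζ y]
  simp [hD _ _ (D.ξ_mem_center _), hD.g_σ (D.ξ_mem_center _)]

variable (hJ : ∀ z ∈ LieAlgebra.center ℝ 𝔤, S.J z ∈ LieAlgebra.center ℝ 𝔤)
include hJ

theorem σ_P_J_σ (hD : D.IsOrthogonal S) (u : Fin k → ℝ) :
    D.σ (D.P (S.J (D.σ u))) = S.J (D.σ u) :=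
  hD.σ_P_of_orthogonal fun z hz => by
    rw [← neg_eq_zero, ← S.g_J_left, hD.g_σ (hJ z hz)]

theorem F_eq (hD : D.IsOrthogonal S) (x y : 𝔤) :
    S.F x y = S.F (D.σ (D.P x)) (D.σ (D.P y)) + S.F (D.ξ (D.ζ x)) (D.ξ (D.ζ y)) := by
  have hσξ : ∀ u s, S.F (D.σ u) (D.ξ s) = 0 := fun u s => hD u _ (hJ _ (D.ξ_mem_center s))
  conv_lhs => rw [← D.σ_P_add_ξ_ζ x, ← D.σ_P_add_ξ_ζ y]
  simp [hσξ, S.F_swap (D.ξ _) (D.σ _)]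

/-- The Hermitian structure that an orthogonal splitting induces on the quotient `𝔤 / 𝔷 = ℝᵏ`. -/
def baseStructure (hD : D.IsOrthogonal S) : HermitianStructure (Fin k → ℝ) where
  g := S.g.compl₁₂ D.σ D.σ
  J := D.P ∘ₗ S.J ∘ₗ D.σ
  g_symm _ _ := S.g_symm _ _
  g_pos u hu := S.g_pos _ fun h => hu (by rw [← D.P_σ u, h, map_zero])
  J_sq u := by simp [hD.σ_P_J_σ hJ, S.J_sq]
  g_J u v := by simp [hD.σ_P_J_σ hJ, S.g_J]

theorem baseStructure_F (hD : D.IsOrthogonal S) (u v : Fin k → ℝ) :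
    (hD.baseStructure hJ).F u v = S.F (D.σ u) (D.σ v) :=
  congrArg (S.g (D.σ u)) (hD.σ_P_J_σ hJ v)

omit hJ

theorem isAntiSelfDual_curvature {D : CentralSplitting 𝔤 4 m} (hD : D.IsOrthogonal S)
    (hab : S.IsAbelian) (hF : S.IsBalanced) {z : 𝔤} (hz : z ∈ LieAlgebra.center ℝ 𝔤) :
    (hD.baseStructure fun _ => hab.J_mem_center).IsAntiSelfDual (D.curvature (S.g z)) := by
  refine HermitianStructure.isAntiSelfDual_of_primitive (by simp)
    (fun u => dOneBilin_isAlt _ (D.σ u)) (fun u v => ?_) ?_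
  · change D.curvature (S.g z) (D.P (S.J (D.σ u))) (D.P (S.J (D.σ v))) = _
    rw [curvature_P, curvature_apply, dOne, hab, dOne]
  · have hFσ : ofBilin (hD.baseStructure fun _ => hab.J_mem_center).F =
        fun w => ofBilin S.F (D.σ ∘ w) := funext fun w => hD.baseStructure_F _ _ _
    rw [hFσ]
    exact funext fun f => hF.wedge_dOneBilin (f := D.σ ∘ f) (hab.J_mem_center hz)
      fun i => hD.g_σ hz _

end IsOrthogonal

theorem bijective_g_ξ {D : CentralSplitting 𝔤 k 2} {c : 𝔤} (hab : S.IsAbelian)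
    (hcenter : Module.finrank ℝ (LieAlgebra.center ℝ 𝔤) = 2) (hc : S.g c c = 1)
    (hcz : c ∈ LieAlgebra.center ℝ 𝔤) : Function.Bijective
    fun (s : Fin 2 → ℝ) (i : Fin 2) => (![S.g (S.J c), S.g c] i) (D.ξ s) := by
  let f : (Fin 2 → ℝ) →ₗ[ℝ] Fin 2 → ℝ := LinearMap.pi ![S.g (S.J c), S.g c] ∘ₗ D.ξ
  have hinj : Function.Injective f := by
    refine (injective_iff_map_eq_zero f).2 fun s hs => ?_
    have hJc : S.g (S.J c) (D.ξ s) = 0 := congrFun hs 0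
    have hc' : S.g c (D.ξ s) = 0 := congrFun hs 1
    rw [← D.ζ_ξ s, HermitianStructure.eq_smul_add_smul_of_mem hcenter hc hcz
      (hab.J_mem_center hcz) (D.ξ_mem_center s), hJc, hc']
    simp
  exact ⟨hinj, LinearMap.injective_iff_surjective.1 hinj⟩

/-- The bundle of an integral orthogonal splitting. The connection forms are the metric duals of
the unitary basis `J c`, `c` of the centre. -/
def torusBundle [IsTwoStepNilpotent 𝔤] {Γ : Subgroup (SimplyConnectedGroup 𝔤)}
    {D : CentralSplitting 𝔤 4 2} (hD : D.IsIntegral Γ) (horth : D.IsOrthogonal S)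
    (hab : S.IsAbelian) (hF : S.IsBalanced)
    (hcenter : Module.finrank ℝ (LieAlgebra.center ℝ 𝔤) = 2) {c : 𝔤} (hc : S.g c c = 1)
    (hcz : c ∈ LieAlgebra.center ℝ 𝔤) : AntiSelfDualTorusBundle Γ S where
  π := hD.proj
  act := D.act Γ
  isPrincipal := hD.isPrincipalTorusBundle
  P := D.P
  P_lie := D.P_lie
  π_mk _ := rfl
  ξ := D.ξ
  act_mk := hD.act_mk
  base := horth.baseStructure fun _ => hab.J_mem_center
  η := ![S.g (S.J c), S.g c]
  η_ξ := bijective_g_ξ hab hcenter hc hcz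
  g_eq x y := by
    have hJcz := hab.J_mem_center hcz
    rw [horth.g_eq, HermitianStructure.g_eq_of_mem hcenter hc hcz hJcz _ (D.ξ_mem_center _),
      horth.g_ξ_ζ hcz, horth.g_ξ_ζ hcz, horth.g_ξ_ζ hJcz, horth.g_ξ_ζ hJcz, ← add_assoc]
    rfl
  F_eq x y := by
    have hJcz := hab.J_mem_center hcz
    rw [horth.F_eq fun _ => hab.J_mem_center, horth.baseStructure_F,
      HermitianStructure.F_eq_of_mem hcenter hc hcz hJcz _ (D.ξ_mem_center _),
      horth.g_ξ_ζ hcz, horth.g_ξ_ζ hcz, horth.g_ξ_ζ hJcz, horth.g_ξ_ζ hJcz]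
    rfl
  Ω i := D.curvature (![S.g (S.J c), S.g c] i)
  dη_eq i x y := (D.curvature_P _ x y).symm
  antiSelfDual := Fin.forall_fin_two.2
    ⟨horth.isAntiSelfDual_curvature hab hF (hab.J_mem_center hcz),
      horth.isAntiSelfDual_curvature hab hF hcz⟩

end CentralSplitting

section Main

variable {𝔤 : Type*} [LieRing 𝔤] [LieAlgebra ℝ 𝔤] [IsTwoStepNilpotent 𝔤]
  {S : HermitianStructure 𝔤}

theorem nonempty_antiSelfDualTorusBundle (hdim : Module.finrank ℝ 𝔤 = 6)
    {Γ : Subgroup (SimplyConnectedGroup 𝔤)} (hΓ : IsLattice Γ) (hF : S.IsBalanced)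
    (hab : S.IsAbelian) : Nonempty (AntiSelfDualTorusBundle Γ S) := by
  have : Module.Finite ℝ 𝔤 := Module.finite_of_finrank_pos (by omega)
  have hcenter := hF.finrank_center hab hdim
  obtain ⟨a, b, c, hcz, hf⟩ := S.exists_isUnitary_mem_center hdim hcenter
  obtain ⟨D, horth⟩ := CentralSplitting.exists_isOrthogonal (k := 4) S hdim hcenter
  obtain ⟨A, C, hD⟩ := D.exists_isIntegral_change hΓ
  exact ⟨CentralSplitting.torusBundle hD (horth.change A C) hab hF hcenter
    (hf.orthonormal 2 2) hcz⟩

theorem nonempty_lieEquiv_H3_or_H5 (hdim : Module.finrank ℝ 𝔤 = 6) (hF : S.IsBalanced)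
    (hab : S.IsAbelian) : Nonempty (𝔤 ≃ₗ⁅ℝ⁆ H3) ∨ Nonempty (𝔤 ≃ₗ⁅ℝ⁆ H5) := by
  have : Module.Finite ℝ 𝔤 := Module.finite_of_finrank_pos (by omega)
  obtain ⟨a, q, haq⟩ := HermitianStructure.exists_isQuaternionicFrame hF hab hdim
  exact haq.nonempty_lieEquiv hdim (hF.finrank_center hab hdim)

end Main

end Nilmanifold

end

theorem mainTheorem6_general {𝔤 : Type*} [LieRing 𝔤] [LieAlgebra ℝ 𝔤]
    [Nilmanifold.IsTwoStepNilpotent 𝔤] (hdim : Module.finrank ℝ 𝔤 = 6)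
    (Γ : Subgroup (Nilmanifold.SimplyConnectedGroup 𝔤)) (hΓ : Nilmanifold.IsLattice Γ)
    (S : Nilmanifold.HermitianStructure 𝔤) (hF : S.IsBalanced) :
    (Nonempty (Nilmanifold.AntiSelfDualTorusBundle Γ S) ↔ S.IsAbelian) ∧
      (S.IsAbelian → Nonempty (𝔤 ≃ₗ⁅ℝ⁆ Nilmanifold.H3) ∨ Nonempty (𝔤 ≃ₗ⁅ℝ⁆ Nilmanifold.H5)) :=
  ⟨⟨fun ⟨T⟩ => T.isAbelian hdim, Nilmanifold.nonempty_antiSelfDualTorusBundle hdim hΓ hF⟩,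
    Nilmanifold.nonempty_lieEquiv_H3_or_H5 hdim hF⟩

theorem mainTheorem6 {𝔤 : Type*} [LieRing 𝔤] [LieAlgebra ℝ 𝔤]
    [Nilmanifold.IsTwoStepNilpotent 𝔤] (hdim : Module.finrank ℝ 𝔤 = 6)
    (Γ : Subgroup (Nilmanifold.SimplyConnectedGroup 𝔤)) (hΓ : Nilmanifold.IsLattice Γ)
    (S : Nilmanifold.HermitianStructure 𝔤) (hJ : S.IsIntegrable) (hF : S.IsBalanced) :
    (Nonempty (Nilmanifold.AntiSelfDualTorusBundle Γ S) ↔ S.IsAbelian) ∧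
      (S.IsAbelian → Nonempty (𝔤 ≃ₗ⁅ℝ⁆ Nilmanifold.H3) ∨ Nonempty (𝔤 ≃ₗ⁅ℝ⁆ Nilmanifold.H5)) :=
  mainTheorem6_general hdim Γ hΓ S hF
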